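/- Let $\mathrm{twr}(0)=1$ and $\mathrm{twr}(i+1)=2^{\mathrm{twr}(i)}$. A quadratic factor $\mathcal B$ of complexity $D$ on $\mathbb F_p^n$ is the partition of $\mathbb F_p^n$ into the simultaneous level sets (atoms) of polynomials $P_1,\dots,P_D$ in $n$ variables over $\mathbb F_p$ of degree at most $2$. Its linear layer $\mathcal B[1]$ is the partition into the simultaneous level sets of those $P_i$ that have degree exactly $1$. Its rank is the minimum, over all non-zero linear combinations $Q$ of those $P_i$ that have degree exactly $2$ (non-zero meaning that the coefficients are not all zero), of the rank of the symmetric bilinear form $(x,y)\mapsto Q(x+y)-Q(x)-Q(y)+Q(0)$, where for a formal polynomial the form is the one with matrix $M+M^{T}$ if $Q(x)=x^TMx+(\text{terms of degree}\le 1)$; for $p$ odd this is the rank of the unique symmetric such matrix $M$. The rank is $\infty$ if no $P_i$ has degree $2$. Write $\mathbb E(f|\mathcal B)(x)$ for the average of $f$ over the atom containing $x$, $\|g\|_{L_2}=(\mathbb E_x g(x)^2)^{1/2}$, and, for real-valued $g$, $\|g\|_{U^3}=\bigl(\mathbb E_{x,h_1,h_2,h_3}\prod_{S\subseteq\{1,2,3\}}g(x+\sum_{i\in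 S}h_i)\bigr)^{1/8}$. Given $\delta>0$, $\omega,R:\mathbb N\to\mathbb N$ and $f:\mathbb F_p^n\to[0,1]$, the factor $\mathcal B$ is a $(\delta,\omega,R)$-quadratic regularity partition for $f$ if its rank is at least $R(D)$ and there is $f_{err}:\mathbb F_p^n\to[-1,1]$ with $\|f_{err}\|_{L_2}<\delta$ and $\|f-\mathbb E(f|\mathcal B)-f_{err}\|_{U^3}<1/\omega(D)$. **Theorem.** Let $p$ be a prime and let $\delta>0$ be such that $\lfloor \delta^{-1/3}/(60p)\rfloor\ge 1$. There is $n_0=n_0(p,\delta)$ such that for all $n\ge n_0$ the following holds. Let $\omega,R:\mathbb N\to\mathbb N$ be non-decreasing functions with $\omega(d)\ge\delta^{-2/3}p^d$ and $R(d)\ge 2\bigl(d+1+\log_p(\delta^{-1/3})\bigr)$ for all $d\in\mathbb N$. Then there is a function $f:\mathbb F_p^n\to[0,1]$ such that, for every $(\delta,\omega,R)$-quadratic regularity partition $\mathcal B$ for $f$, the linear layer $\mathcal B[1]$ is the partition of $\mathbb F_p^n$ into the cosets of a subspace of codimension at least $\mathrm{twr}\bigl(\lfloor\delta^{-1/3}/(60p)\rfloor-1\bigr)$.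 -/

import Mathlib

open scoped BigOperators

/-- The tower function: `twr 0 = 1` and `twr (i + 1) = 2 ^ twr i`. -/
def twr : ℕ → ℕ
  | 0 => 1
  | i + 1 => 2 ^ twr i

namespace QuadReg

noncomputable section

/-- The partition of `𝔽_p ^ n` into the simultaneous level sets of a family of polynomials,
as an equivalence relation. -/
def levelSets {p n : ℕ} {ι : Type} (P : ι → MvPolynomial (Fin n) (ZMod p)) :
    Setoid (Fin n → ZMod p) where
  r x y := ∀ i, MvPolynomial.eval x (P i) = MvPolynomial.eval y (P i)
  iseqv := ⟨fun _ _ => rfl, fun h i => (h i).symm, fun h k i => (h i).trans (k i)⟩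

/-- A quadratic factor of complexity `D` on `𝔽_p ^ n`, given by polynomials `P_1, …, P_D` of
degree at most `2`. -/
structure QuadraticFactor (p n D : ℕ) where
  /-- the defining polynomials -/
  poly : Fin D → MvPolynomial (Fin n) (ZMod p)
  /-- they have degree at most two -/
  degree_le : ∀ i, (poly i).totalDegree ≤ 2

/-- The matrix of the symmetric bilinear form `Q (x + y) - Q x - Q y + Q 0` attached to a
polynomial `Q` of degree at most `2`. If `Q (x) = xᵀ M x + (terms of degree at most one)`, it is
`M + Mᵀ` (see `polarMatrix_eq`). For `p` odd it is twice the unique symmetric such `M`. -/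
def polarMatrix {p n : ℕ} (Q : MvPolynomial (Fin n) (ZMod p)) :
    Matrix (Fin n) (Fin n) (ZMod p) :=
  Matrix.of fun i j =>
    (if i = j then 2 else 1) * MvPolynomial.coeff (Finsupp.single i 1 + Finsupp.single j 1) Q

/-- The rank of a quadratic polynomial. For `p` odd this is the rank of the unique symmetric
matrix `M` such that `Q (x) = xᵀ M x + (terms of degree at most one)`
(see `quadraticRank_eq`). -/
def quadraticRank {p n : ℕ} (Q : MvPolynomial (Fin n) (ZMod p)) : ℕ :=
  (polarMatrix Q).rank

open MvPolynomial in
theorem polarMatrix_eq {p n : ℕ} (M : Matrix (Fin n) (Fin n) (ZMod p))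
    (L : MvPolynomial (Fin n) (ZMod p)) (hL : L.totalDegree ≤ 1) :
    polarMatrix ((∑ i, ∑ j, MvPolynomial.C (M i j) * MvPolynomial.X i * MvPolynomial.X j) + L)
      = M + M.transpose := by
  ext a b
  simp only [polarMatrix, Matrix.of_apply, Matrix.add_apply, Matrix.transpose_apply]
  have h0 : coeff (Finsupp.single a 1 + Finsupp.single b 1) L = 0 := by
    apply coeff_eq_zero_of_totalDegree_lt
    refine lt_of_le_of_lt hL ?_
    have : (Finsupp.single a 1 + Finsupp.single b 1 : Fin n →₀ ℕ).degree = 2 := by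
      simp [Finsupp.degree_single]
    rw [Finsupp.degree_apply] at this
    omega
  have h1 : ∀ i j, coeff (Finsupp.single a 1 + Finsupp.single b 1) (C (M i j) * X i * X j : MvPolynomial (Fin n) (ZMod p)) = if (i = a ∧ j = b) ∨ (i = b ∧ j = a) then M i j else 0 := by
    intro i j
    have : (C (M i j) * X i * X j : MvPolynomial (Fin n) (ZMod p)) = monomial (Finsupp.single i 1 + Finsupp.single j 1) (M i j) := by
      rw [C_mul_X_eq_monomial, X, monomial_mul, mul_one]
    rw [this, coeff_monomial]
    congr 1
    rw [eq_iff_iff]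
    constructor
    · intro h
      have := (Finsupp.single_add_single_eq_single_add_single (k := i) (l := j) (m := a) (n := b) (u := 1) (v := 1) (by decide) (by decide)).1 h
      simp at this
      tauto
    · rintro (⟨rfl, rfl⟩ | ⟨rfl, rfl⟩)
      · rfl
      · rw [add_comm]
  simp only [coeff_add, coeff_sum, h0, h1, add_zero]
  by_cases hab : a = b
  · subst hab
    simp [ite_and, two_mul]
  · have : ∀ i j, (if (i = a ∧ j = b) ∨ (i = b ∧ j = a) then M i j else 0) = (if i = a then if j = b then M i j else 0 else 0) + (if i = b then if j = a then M i j else 0 else 0) := by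
      intro i j
      by_cases h1 : i = a <;> by_cases h2 : i = b <;> by_cases h3 : j = a <;> by_cases h4 : j = b <;> simp_all
    simp only [this, Finset.sum_add_distrib, if_neg hab, one_mul]
    congr 1
    · simp
    · simp

theorem quadraticRank_eq {p n : ℕ} [Fact p.Prime] (hp : p ≠ 2)
    (M : Matrix (Fin n) (Fin n) (ZMod p)) (hM : M.IsSymm)
    (L : MvPolynomial (Fin n) (ZMod p)) (hL : L.totalDegree ≤ 1) :
    quadraticRank
      ((∑ i, ∑ j, MvPolynomial.C (M i j) * MvPolynomial.X i * MvPolynomial.X j) + L)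
      = M.rank := by
  have h2 : (2 : ZMod p) ≠ 0 := Ring.two_ne_zero (by rwa [ZMod.ringChar_zmod_n])
  rw [quadraticRank, polarMatrix_eq M L hL, hM.eq, ← two_smul (ZMod p) M]
  exact Matrix.rank_smul_of_mem_nonZeroDivisors M (mem_nonZeroDivisors_of_ne_zero h2)

namespace QuadraticFactor

variable {p n D : ℕ}

/-- The partition into atoms: two points are equivalent if they lie in the same atom. -/
def atoms (B : QuadraticFactor p n D) : Setoid (Fin n → ZMod p) := levelSets B.poly

/-- The linear layer `𝓑[1]`: the partition defined by the polynomials of degree exactly one. -/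
def linearLayer (B : QuadraticFactor p n D) : Setoid (Fin n → ZMod p) :=
  levelSets fun i : {i : Fin D // (B.poly i).totalDegree = 1} => B.poly i

/-- The rank of a factor: the minimum rank of a non-zero linear combination of those defining
polynomials that have degree exactly two (`⊤` if there are none). -/
def rank (B : QuadraticFactor p n D) : ℕ∞ :=
  ⨅ (c : {i : Fin D // (B.poly i).totalDegree = 2} → ZMod p) (_ : c ≠ 0),
    (quadraticRank (∑ i, c i • B.poly i) : ℕ∞)

open scoped Classical in
/-- The projection `𝔼(f | 𝓑)`: its value at `x` is the average of `f` over the atom of `x`. -/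
def project [NeZero p] (B : QuadraticFactor p n D) (f : (Fin n → ZMod p) → ℝ) :
    (Fin n → ZMod p) → ℝ :=
  fun x => 𝔼 y ∈ Finset.univ.filter (fun y => B.atoms.r x y), f y

end QuadraticFactor

/-- The `L_2` norm with respect to the uniform probability measure. -/
def l2Norm {V : Type} [Fintype V] (g : V → ℝ) : ℝ := Real.sqrt (𝔼 x, g x ^ 2)

/-- The Gowers `U^3` norm of a real-valued function: its eighth power is the average over
`x, h_1, h_2, h_3` of the product of `g (x + ∑_{i ∈ S} h_i)` over `S ⊆ {1, 2, 3}`. -/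
def u3Norm {V : Type} [Fintype V] [AddCommGroup V] (g : V → ℝ) : ℝ :=
  (𝔼 x : V, 𝔼 h : Fin 3 → V, ∏ S : Finset (Fin 3), g (x + ∑ i ∈ S, h i)) ^ (1 / 8 : ℝ)

/-- `B` is a `(δ, ω, R)`-quadratic regularity partition for `f`. -/
def IsQuadraticRegularityPartition {p n D : ℕ} [NeZero p] (δ : ℝ) (ω R : ℕ → ℕ)
    (f : (Fin n → ZMod p) → ℝ) (B : QuadraticFactor p n D) : Prop :=
  (R D : ℕ∞) ≤ B.rank ∧
    ∃ ferr : (Fin n → ZMod p) → ℝ, (∀ x, ferr x ∈ Set.Icc (-1 : ℝ) 1) ∧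
      l2Norm ferr < δ ∧ u3Norm (f - B.project f - ferr) < 1 / (ω D : ℝ)

end

end QuadReg

namespace QuadReg

/-! ### Characters, differencing and the `U^3` norm -/

section Fourier

/-! The function `f` is built on a chain `W 0 = ⊤ ≥ W 1 ≥ … ≥ W N` whose codimensions grow like a
tower. At step `j` every coset of `W j` gets its own functional `ξ j x`, which vanishes on `W (j +
1)` but not on `W j`, and `f` averages over `j` the indicators of `ξ j x x = 0`. A code makes the
growth exponential: the functionals are indexed by about `p ^ D` cosets, `D` the codimension of `W
j`, so they can separate a space of dimension exponential in `D`, with each vector of `W j` outside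
`W (j + 1)` seen by at least a quarter of them (`exists_isSeparatingFamily`,
`exists_refinement_chain`).

Let `H` be the common kernel of the linear parts of the linear layer. Induction on `i` gives `H ≤ W
i` for all `i ≤ N`, so `H` has at least the codimension of `W N`. Suppose `H ≤ W i` and some `v ∈ H`
lies outside `W (i + 1)`. Test `f` against `φ x = e(ξ i x x)`, cut off to the points where `ξ i x v
≠ 0`. The steps `j ≠ i` are orthogonal to `φ` and step `i` contributes at least `1 / (4 p N)`
(`le_norm_expect_chainFunction_mul`).

Each piece of the regularity decomposition correlates too little with `φ`. As `H ≤ W i`, `φ` is a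
multiple of a linear character on each coset of `H`, so the `U^3`-small part costs at most `p ^ D /
ω D`, where `D` is now the complexity. The `L_2` error costs less than `δ`. In the projection,
functions of the linear layer are invariant under `v` and hence orthogonal to `φ`; the rest consists
of quadratic phases of high rank, controlled by Gauss sums (`QuadraticFactor.norm_expect_mul_le`).
The total stays below `1 / (4 p N)` by `error_sum_le`, a contradiction. -/

theorem expect_comp_add_right {V M : Type*} [Fintype V] [AddGroup V] [AddCommMonoid M]
    [Module ℚ≥0 M] (f : V → M) (a : V) : 𝔼 x, f (x + a) = 𝔼 x, f x :=
  Fintype.expect_equiv (Equiv.addRight a) _ _ fun _ => rfl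

theorem sq_expect_le {ι : Type*} [Fintype ι] [Nonempty ι] (f : ι → ℝ) :
    (𝔼 i, f i) ^ 2 ≤ 𝔼 i, f i ^ 2 := by
  simpa using Finset.expect_mul_sq_le_sq_mul_sq Finset.univ f fun _ => 1

/-- The square of an average is the average of the correlations of the function with its
shifts. -/
theorem sq_expect_eq {V : Type*} [Fintype V] [AddCommGroup V] (g : V → ℝ) :
    (𝔼 x, g x) ^ 2 = 𝔼 h, 𝔼 x, g x * g (x + h) := by
  rw [sq, Finset.expect_mul_expect, Finset.expect_comm (s := Finset.univ)
    (f := fun h x => g x * g (x + h))]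
  refine Finset.expect_congr rfl fun x _ => ?_
  exact (Fintype.expect_equiv (Equiv.addLeft x) _ _ fun _ => rfl).symm

theorem normSq_expect_eq {V : Type*} [Fintype V] [AddCommGroup V] (F : V → ℂ) :
    ((‖𝔼 x, F x‖ ^ 2 : ℝ) : ℂ) = 𝔼 h, 𝔼 x, F (x + h) * starRingEnd ℂ (F x) := by
  have h1 : ((‖𝔼 x, F x‖ ^ 2 : ℝ) : ℂ) = (𝔼 x, F x) * starRingEnd ℂ (𝔼 x, F x) := by
    rw [Complex.mul_conj, Complex.normSq_eq_norm_sq]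
  have h2 : starRingEnd ℂ (𝔼 x, F x) = 𝔼 x, starRingEnd ℂ (F x) := by
    simp [Fintype.expect_eq_sum_div_card, map_sum]
  rw [h1, h2, mul_comm, Finset.expect_mul_expect, Finset.expect_comm (s := Finset.univ)
    (f := fun h x => F (x + h) * starRingEnd ℂ (F x))]
  refine Finset.expect_congr rfl fun x _ => ?_
  refine (Fintype.expect_equiv (Equiv.addLeft x) _ _ fun h => ?_).symm
  simp [mul_comm]

/-- Expanding the square by `sq_expect_eq` produces the third shift; the eight factors are then the
vertices of the cube. This is the form reached by repeated Cauchy–Schwarz. -/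
theorem expect_cube_eq {V : Type} [Fintype V] [AddCommGroup V] (g : V → ℝ) :
    (𝔼 h₁, 𝔼 h₂, (𝔼 x, (g x * g (x + h₁)) * (g (x + h₂) * g (x + h₂ + h₁))) ^ 2) =
      𝔼 x : V, 𝔼 h : Fin 3 → V, ∏ S : Finset (Fin 3), g (x + ∑ i ∈ S, h i) := by
  have huniv : (Finset.univ : Finset (Finset (Fin 3))) =
      {∅, {0}, {1}, {2}, {0, 1}, {0, 2}, {1, 2}, {0, 1, 2}} := by decide
  have h1 : ∀ h₁ h₂ : V, (𝔼 x, (g x * g (x + h₁)) * (g (x + h₂) * g (x + h₂ + h₁))) ^ 2 =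
      𝔼 h₃, 𝔼 x, ∏ S : Finset (Fin 3), g (x + ∑ i ∈ S, ![h₁, h₂, h₃] i) := by
    intro h₁ h₂
    rw [sq_expect_eq]
    refine Finset.expect_congr rfl fun h₃ _ => Finset.expect_congr rfl fun x _ => ?_
    rw [huniv]
    repeat rw [Finset.prod_insert (by decide)]
    rw [Finset.prod_singleton]
    have e01 : (∑ i ∈ ({0, 1} : Finset (Fin 3)), ![h₁, h₂, h₃] i) = h₁ + h₂ := by
      rw [Finset.sum_pair (by decide)]; rfl
    have e02 : (∑ i ∈ ({0, 2} : Finset (Fin 3)), ![h₁, h₂, h₃] i) = h₁ + h₃ := by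
      rw [Finset.sum_pair (by decide)]; rfl
    have e12 : (∑ i ∈ ({1, 2} : Finset (Fin 3)), ![h₁, h₂, h₃] i) = h₂ + h₃ := by
      rw [Finset.sum_pair (by decide)]; rfl
    have e012 : (∑ i ∈ ({0, 1, 2} : Finset (Fin 3)), ![h₁, h₂, h₃] i) = h₁ + (h₂ + h₃) := by
      rw [Finset.sum_insert (by decide), Finset.sum_pair (by decide)]; rfl
    rw [e01, e02, e12, e012, Finset.sum_empty, Finset.sum_singleton, Finset.sum_singleton,
      Finset.sum_singleton, add_zero]
    have a1 : x + h₂ + h₁ = x + (h₁ + h₂) := by abel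
    have a2 : x + h₃ + h₁ = x + (h₁ + h₃) := by abel
    have a3 : x + h₃ + h₂ = x + (h₂ + h₃) := by abel
    have a4 : x + (h₂ + h₃) + h₁ = x + (h₁ + (h₂ + h₃)) := by abel
    rw [a1, a2, a3, a4]
    simp only [Matrix.cons_val]
    ring
  simp only [h1]
  rw [Finset.expect_comm (s := Finset.univ) (t := Finset.univ)
    (f := fun (x : V) (h : Fin 3 → V) => ∏ S : Finset (Fin 3), g (x + ∑ i ∈ S, h i))]
  symm
  let e : (Fin 3 → V) ≃ V × V × V :=
    { toFun := fun h => (h 0, h 1, h 2)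
      invFun := fun t => ![t.1, t.2.1, t.2.2]
      left_inv := fun h => by ext i; fin_cases i <;> rfl
      right_inv := fun t => rfl }
  rw [Fintype.expect_equiv e _ (fun t : V × V × V =>
    𝔼 x, ∏ S : Finset (Fin 3), g (x + ∑ i ∈ S, ![t.1, t.2.1, t.2.2] i))]
  · rw [← Finset.univ_product_univ, Finset.expect_product]
    refine Finset.expect_congr rfl fun h₁ _ => ?_
    rw [← Finset.univ_product_univ, Finset.expect_product]
  · intro h
    have : ![(e h).1, (e h).2.1, (e h).2.2] = h := e.symm_apply_apply h
    rw [this]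

/-- The correlation of a function with a linear character is bounded by its `U^3` norm. -/
theorem norm_expect_mul_addChar_le_u3Norm {V : Type} [Fintype V] [AddCommGroup V] (g : V → ℝ)
    (ψ : AddChar V ℂ) : ‖𝔼 x, (g x : ℂ) * ψ x‖ ≤ u3Norm g := by
  set N := ‖𝔼 x, (g x : ℂ) * ψ x‖ with hN
  have hN0 : 0 ≤ N := norm_nonneg _
  have h1 : N ^ 2 ≤ 𝔼 h, |𝔼 x, g x * g (x + h)| := by
    have h2 := normSq_expect_eq fun x => (g x : ℂ) * ψ x
    have h3 : N ^ 2 = ‖((N ^ 2 : ℝ) : ℂ)‖ := by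
      rw [Complex.norm_real, Real.norm_of_nonneg (by positivity)]
    rw [h3, h2]
    refine (RCLike.norm_expect_le (K := ℂ)).trans (Finset.expect_le_expect fun h _ => le_of_eq ?_)
    -- Differencing turns `ψ` into the constant `ψ h` of modulus one, so the character disappears
    -- from the bound.
    have h4 : ∀ x, (g (x + h) : ℂ) * ψ (x + h) * starRingEnd ℂ ((g x : ℂ) * ψ x) =
        ψ h * ((g x * g (x + h) : ℝ) : ℂ) := by
      intro x
      have h5 : ψ x * starRingEnd ℂ (ψ x) = 1 := by
        rw [Complex.mul_conj, Complex.normSq_eq_norm_sq, AddChar.norm_apply]; simp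
      rw [AddChar.map_add_eq_mul, map_mul, Complex.conj_ofReal]
      push_cast
      linear_combination (g (x + h) : ℂ) * ψ h * g x * h5
    simp only [h4]
    rw [← Finset.mul_expect, norm_mul, AddChar.norm_apply, one_mul]
    have h6 : (𝔼 x, ((g x * g (x + h) : ℝ) : ℂ)) = ((𝔼 x, g x * g (x + h) : ℝ) : ℂ) := by
      simp [Fintype.expect_eq_sum_div_card]
    rw [h6, Complex.norm_real, Real.norm_eq_abs]
  have h2 : N ^ 4 ≤ 𝔼 h₁, 𝔼 h₂, 𝔼 x, (g x * g (x + h₁)) * (g (x + h₂) * g (x + h₂ + h₁)) := by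
    calc N ^ 4 = (N ^ 2) ^ 2 := by ring
      _ ≤ (𝔼 h, |𝔼 x, g x * g (x + h)|) ^ 2 := by gcongr
      _ ≤ 𝔼 h, |𝔼 x, g x * g (x + h)| ^ 2 := sq_expect_le _
      _ = _ := by simp only [sq_abs, sq_expect_eq (fun x => g x * g (x + _))]
  have h3 : N ^ 8 ≤ 𝔼 x : V, 𝔼 h : Fin 3 → V, ∏ S : Finset (Fin 3), g (x + ∑ i ∈ S, h i) := by
    rw [← expect_cube_eq]
    calc N ^ 8 = (N ^ 4) ^ 2 := by ring
      _ ≤ (𝔼 h₁, 𝔼 h₂, 𝔼 x, (g x * g (x + h₁)) * (g (x + h₂) * g (x + h₂ + h₁))) ^ 2 := by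
        gcongr
      _ ≤ _ := (sq_expect_le _).trans (Finset.expect_le_expect fun _ _ => sq_expect_le _)
  calc N = (N ^ 8) ^ (1 / 8 : ℝ) := by
        rw [← Real.rpow_natCast, ← Real.rpow_mul hN0]; norm_num
    _ ≤ _ := Real.rpow_le_rpow (by positivity) h3 (by norm_num)

variable {p : ℕ} [Fact p.Prime] {V : Type*} [AddCommGroup V] [Module (ZMod p) V]

/-- The character `x ↦ e(ℓ x)` attached to a linear functional `ℓ`. -/
noncomputable def linChar (ℓ : Module.Dual (ZMod p) V) : AddChar V ℂ :=
  (ZMod.stdAddChar (N := p)).compAddMonoidHom ℓ.toAddMonoidHom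

theorem linChar_apply (ℓ : Module.Dual (ZMod p) V) (x : V) :
    linChar ℓ x = ZMod.stdAddChar (ℓ x) := rfl

theorem linChar_eq_zero_iff (ℓ : Module.Dual (ZMod p) V) : linChar ℓ = 0 ↔ ℓ = 0 := by
  constructor
  · intro h
    by_contra hl
    obtain ⟨x, hx⟩ := DFunLike.ne_iff.1 hl
    have h1 : ∀ t : ZMod p, ZMod.stdAddChar t = (1 : ℂ) := by
      intro t
      have := DFunLike.congr_fun h ((t / ℓ x) • x)
      rw [linChar_apply, map_smul, smul_eq_mul, div_mul_cancel₀ _ (by simpa using hx)] at this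
      simpa using this
    have h2 : (1 : ZMod p) = 0 := ZMod.injective_stdAddChar ((h1 1).trans (h1 0).symm)
    exact one_ne_zero h2
  · rintro rfl
    ext x
    simp [linChar_apply]

theorem expect_linChar [Fintype V] (ℓ : Module.Dual (ZMod p) V) [Decidable (ℓ = 0)] :
    𝔼 x, linChar ℓ x = if ℓ = 0 then 1 else 0 := by
  classical
  rw [AddChar.expect_eq_ite]
  simp only [linChar_eq_zero_iff]

/-- Orthogonality of the characters of `𝔽_p ^ J`. -/
theorem expect_stdAddChar_dotProduct {J : Type*} [Fintype J] [DecidableEq J] (a : J → ZMod p) :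
    𝔼 t : J → ZMod p, (ZMod.stdAddChar (∑ j, t j * a j) : ℂ) = if a = 0 then 1 else 0 := by
  have h := expect_linChar (dotProductEquiv (ZMod p) J a)
  have h0 : dotProductEquiv (ZMod p) J a = 0 ↔ a = 0 := by simp
  simp only [h0] at h
  rw [← h]
  refine Finset.expect_congr rfl fun t _ => ?_
  rw [linChar_apply]
  congr 1
  exact Finset.sum_congr rfl fun j _ => mul_comm _ _

/-- A function which correlates with no character correlates with no function that is, on every
joint level set of a few linear functionals, a multiple of a character. -/
theorem norm_expect_mul_le_of_piecewise [Fintype V] {J : Type*} [Fintype J] [DecidableEq J]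
    (L : J → Module.Dual (ZMod p) V) (F φ : V → ℂ) (ε : ℝ)
    (hF : ∀ ψ : AddChar V ℂ, ‖𝔼 x, F x * ψ x‖ ≤ ε)
    (hφ : ∀ x, ∃ (c : ℂ) (ψ : AddChar V ℂ), ‖c‖ ≤ 1 ∧
      ∀ y, (∀ j, L j y = L j x) → φ y = c * ψ y) :
    ‖𝔼 x, F x * φ x‖ ≤ (p : ℝ) ^ Fintype.card J * ε := by
  have hφ' : ∀ a : J → ZMod p, ∃ (c : ℂ) (ψ : AddChar V ℂ), ‖c‖ ≤ 1 ∧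
      ∀ y, (∀ j, L j y = a j) → φ y = c * ψ y := by
    intro a
    by_cases h : ∃ x, ∀ j, L j x = a j
    · obtain ⟨x, hx⟩ := h
      obtain ⟨c, ψ, hc, hψ⟩ := hφ x
      exact ⟨c, ψ, hc, fun y hy => hψ y fun j => (hy j).trans (hx j).symm⟩
    · exact ⟨0, 0, by simp, fun y hy => (h ⟨y, hy⟩).elim⟩
  choose c ψ hc hψ using hφ'
  have hε : 0 ≤ ε := (norm_nonneg _).trans (hF 0)
  -- The inner average is the indicator of the level set `a`. Its characters are absorbed into `ψ
  -- a`, and the `p ^ card J` level sets account for the loss.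
  have h1 : ∀ x, φ x = ∑ a : J → ZMod p, c a * ψ a x *
      𝔼 t : J → ZMod p, (ZMod.stdAddChar (∑ j, t j * (L j x - a j)) : ℂ) := by
    intro x
    rw [Finset.sum_eq_single fun j => L j x]
    · rw [hψ (fun j => L j x) x fun _ => rfl]
      simp
    · intro a _ ha
      rw [expect_stdAddChar_dotProduct (fun j => L j x - a j), if_neg, mul_zero]
      intro h
      exact ha (funext fun j => (sub_eq_zero.1 (congrFun h j)).symm)
    · simp
  have h2 : 𝔼 x, F x * φ x = ∑ a : J → ZMod p, 𝔼 t : J → ZMod p,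
      (c a * ZMod.stdAddChar (-∑ j, t j * a j)) *
        𝔼 x, F x * (ψ a + linChar (∑ j, t j • L j)) x := by
    simp only [h1, Finset.mul_sum, Finset.mul_expect]
    rw [Finset.expect_sum_comm]
    refine Finset.sum_congr rfl fun a _ => ?_
    rw [Finset.expect_comm]
    refine Finset.expect_congr rfl fun t _ => Finset.expect_congr rfl fun x _ => ?_
    have h3 : (∑ j, t j * (L j x - a j)) = (-∑ j, t j * a j) + (∑ j, t j • L j) x := by
      simp [mul_sub, Finset.sum_sub_distrib]
      ring
    rw [h3, AddChar.map_add_eq_mul, AddChar.add_apply, linChar_apply]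
    ring
  rw [h2]
  calc _ ≤ ∑ a : J → ZMod p, ε := by
        refine norm_sum_le_of_le _ fun a _ => ?_
        refine (RCLike.norm_expect_le (K := ℂ)).trans ?_
        refine Finset.expect_le Finset.univ_nonempty fun t _ => ?_
        rw [norm_mul, norm_mul, AddChar.norm_apply, mul_one]
        calc _ ≤ 1 * ε := mul_le_mul (hc a) (hF _) (norm_nonneg _) zero_le_one
          _ = ε := one_mul _
    _ = _ := by simp [ZMod.card]

end Fourier

/-! ### Quadratic Gauss sums -/

section GaussSum

variable {p : ℕ} [Fact p.Prime] {n : ℕ}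

/-- Bound for a quadratic Gauss sum in terms of the rank of the polar form. -/
theorem normSq_expect_quadratic_le (Q : (Fin n → ZMod p) → ZMod p)
    (M : Matrix (Fin n) (Fin n) (ZMod p))
    (hQ : ∀ x h, Q (x + h) = Q x + Q h - Q 0 + x ⬝ᵥ M.mulVec h)
    (ψ : AddChar (Fin n → ZMod p) ℂ) :
    ‖𝔼 x, (ZMod.stdAddChar (Q x) : ℂ) * ψ x‖ ^ 2 ≤ ((p : ℝ) ^ M.rank)⁻¹ := by
  classical
  set N := ‖𝔼 x, (ZMod.stdAddChar (Q x) : ℂ) * ψ x‖ ^ 2 with hN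
  have hN0 : N = ‖(N : ℂ)‖ := by
    rw [Complex.norm_real, Real.norm_of_nonneg (by positivity)]
  -- After differencing, the phase is linear in `x` with frequency `M h`, so only `h` in the kernel
  -- of `M` survive; that kernel has density `p ^ (-rank)`.
  have h1 : ∀ h : Fin n → ZMod p, 𝔼 x, (ZMod.stdAddChar (Q (x + h)) : ℂ) * ψ (x + h) *
      starRingEnd ℂ ((ZMod.stdAddChar (Q x) : ℂ) * ψ x) =
        ψ h * ZMod.stdAddChar (Q h - Q 0) * if M.mulVec h = 0 then 1 else 0 := by
    intro h
    rw [← expect_stdAddChar_dotProduct, Finset.mul_expect]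
    refine Finset.expect_congr rfl fun x _ => ?_
    have h5 : ψ x * starRingEnd ℂ (ψ x) = 1 := by
      rw [Complex.mul_conj, Complex.normSq_eq_norm_sq, AddChar.norm_apply]; simp
    have h6 : (ZMod.stdAddChar (Q x) : ℂ) * starRingEnd ℂ (ZMod.stdAddChar (Q x)) = 1 := by
      rw [Complex.mul_conj, Complex.normSq_eq_norm_sq, AddChar.norm_apply]; simp
    have h7 : Q (x + h) = Q x + (Q h - Q 0) + ∑ j, x j * M.mulVec h j := by
      rw [hQ, dotProduct]; ring
    rw [h7, AddChar.map_add_eq_mul, AddChar.map_add_eq_mul, AddChar.map_add_eq_mul, map_mul]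
    linear_combination (ZMod.stdAddChar (Q h - Q 0) * ZMod.stdAddChar (∑ j, x j * M.mulVec h j) *
      ψ h : ℂ) * (ψ x * starRingEnd ℂ (ψ x) * h6 + h5)
  rw [hN0, hN, normSq_expect_eq]
  simp only [h1]
  calc _ ≤ 𝔼 h : Fin n → ZMod p, (if M.mulVec h = 0 then 1 else 0 : ℝ) := by
        refine (RCLike.norm_expect_le (K := ℂ)).trans (Finset.expect_le_expect fun h _ => ?_)
        rw [norm_mul, norm_mul, AddChar.norm_apply, AddChar.norm_apply]
        split_ifs <;> simp
    _ = ((p : ℝ) ^ M.rank)⁻¹ := by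
        have hk : Fintype.card (LinearMap.ker M.mulVecLin) * p ^ M.rank = p ^ n := by
          rw [Module.card_eq_pow_finrank (K := ZMod p) (V := LinearMap.ker M.mulVecLin),
            ZMod.card, ← pow_add, Matrix.rank, add_comm,
            LinearMap.finrank_range_add_finrank_ker]
          simp
        have hc : (Finset.univ.filter fun h => M.mulVec h = 0).card =
            Fintype.card (LinearMap.ker M.mulVecLin) := by
          rw [Fintype.card_subtype]
          simp
        have hp : (p : ℝ) ≠ 0 := by exact_mod_cast (Fact.out : p.Prime).ne_zero
        rw [Fintype.expect_eq_sum_div_card, Finset.sum_boole, hc, Fintype.card_fun, ZMod.card,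
          Fintype.card_fin]
        push_cast
        rw [div_eq_iff (by positivity), eq_inv_mul_iff_mul_eq₀ (by positivity), mul_comm]
        exact_mod_cast hk

end GaussSum

end QuadReg

namespace QuadReg

/-! ### Polynomials of degree at most two -/

section Polynomials

open MvPolynomial

variable {p n : ℕ}

theorem eq_zero_or_exists_single_add {σ : Type*} {k : ℕ} {m : σ →₀ ℕ} (hm : m.degree ≤ k + 1) :
    m = 0 ∨ ∃ i m', m = Finsupp.single i 1 + m' ∧ m'.degree ≤ k := by
  classical
  by_cases h : m = 0
  · exact Or.inl h
  · obtain ⟨i, hi⟩ := DFunLike.ne_iff.1 h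
    have hle : Finsupp.single i 1 ≤ m := by
      rw [Finsupp.single_le_iff]
      exact Nat.one_le_iff_ne_zero.2 hi
    refine Or.inr ⟨i, m - Finsupp.single i 1, (add_tsub_cancel_of_le hle).symm, ?_⟩
    have h1 : (Finsupp.single i 1 + (m - Finsupp.single i 1)).degree = m.degree := by
      rw [add_tsub_cancel_of_le hle]
    rw [map_add, Finsupp.degree_single] at h1
    omega

theorem degree_le_of_mem_support {σ R : Type*} [CommSemiring R] {P : MvPolynomial σ R} {k : ℕ}
    (hP : P.totalDegree ≤ k) {m : σ →₀ ℕ} (hm : m ∈ P.support) : m.degree ≤ k :=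
  le_trans (by rw [Finsupp.degree_apply]; exact le_totalDegree hm) hP

/-- A polynomial of degree at most one is an affine function. -/
theorem exists_eval_eq_add_const (P : MvPolynomial (Fin n) (ZMod p)) (hP : P.totalDegree ≤ 1) :
    ∃ (ℓ : Module.Dual (ZMod p) (Fin n → ZMod p)) (c : ZMod p), ∀ x, eval x P = ℓ x + c := by
  rw [← P.support_sum_monomial_coeff]
  refine Finset.sum_induction (fun m => monomial m (coeff m P))
    (fun P => ∃ (ℓ : Module.Dual (ZMod p) (Fin n → ZMod p)) (c : ZMod p),
      ∀ x, eval x P = ℓ x + c) ?_ ⟨0, 0, by simp⟩ ?_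
  · rintro P Q ⟨ℓ, c, h⟩ ⟨ℓ', c', h'⟩
    exact ⟨ℓ + ℓ', c + c', fun x => by rw [map_add, h, h', LinearMap.add_apply]; ring⟩
  · intro m hm
    obtain rfl | ⟨i, m', rfl, hm'⟩ :=
      eq_zero_or_exists_single_add (k := 0) (degree_le_of_mem_support hP hm)
    · exact ⟨0, coeff 0 P, fun x => by simp⟩
    · obtain rfl : m' = 0 := (Finsupp.degree_eq_zero_iff _).1 (by omega)
      rw [add_zero]
      exact ⟨coeff (Finsupp.single i 1) P • LinearMap.proj i, 0, fun x => by simp [eval_monomial]⟩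

/-- A polynomial of degree at most two is a quadratic form plus an affine function. -/
theorem exists_eq_quadratic_add (P : MvPolynomial (Fin n) (ZMod p)) (hP : P.totalDegree ≤ 2) :
    ∃ (M : Matrix (Fin n) (Fin n) (ZMod p)) (L : MvPolynomial (Fin n) (ZMod p)),
      L.totalDegree ≤ 1 ∧ P = (∑ i, ∑ j, C (M i j) * X i * X j) + L := by
  have key := Finset.sum_induction (s := P.support) (fun m => monomial m (coeff m P))
    (fun P => ∃ (M : Matrix (Fin n) (Fin n) (ZMod p)) (L : MvPolynomial (Fin n) (ZMod p)),
      L.totalDegree ≤ 1 ∧ P = (∑ i, ∑ j, C (M i j) * X i * X j) + L) ?_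
      ⟨0, 0, by simp, by simp⟩ ?_
  · rwa [P.support_sum_monomial_coeff] at key
  · rintro P Q ⟨M, L, hL, rfl⟩ ⟨M', L', hL', rfl⟩
    refine ⟨M + M', L + L', (totalDegree_add _ _).trans (max_le hL hL'), ?_⟩
    simp only [Matrix.add_apply, map_add, add_mul, Finset.sum_add_distrib]
    ring
  · intro m hm
    obtain rfl | ⟨i, m', rfl, hm'⟩ :=
      eq_zero_or_exists_single_add (k := 1) (degree_le_of_mem_support hP hm)
    · exact ⟨0, monomial 0 (coeff 0 P), by simp [monomial_zero'], by simp⟩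
    · obtain rfl | ⟨j, m'', rfl, hm''⟩ := eq_zero_or_exists_single_add (k := 0) hm'
      · refine ⟨0, monomial (Finsupp.single i 1 + 0) (coeff (Finsupp.single i 1 + 0) P), ?_,
          by simp⟩
        refine (totalDegree_monomial_le _ _).trans ?_
        simp
      · obtain rfl : m'' = 0 := (Finsupp.degree_eq_zero_iff _).1 (by omega)
        rw [add_zero]
        set c := coeff (Finsupp.single i 1 + Finsupp.single j 1) P
        refine ⟨Matrix.single i j c, 0, by simp, ?_⟩
        rw [Finset.sum_eq_single i, Finset.sum_eq_single j]
        · rw [Matrix.single_apply_same, C_mul_X_eq_monomial, X, monomial_mul, mul_one, add_zero]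
        · intro b _ hb
          rw [Matrix.single_apply_of_ne _ _ _ _ _ (by tauto)]
          simp
        · simp
        · intro b _ hb
          refine Finset.sum_eq_zero fun b' _ => ?_
          rw [Matrix.single_apply_of_ne _ _ _ _ _ (by tauto)]
          simp
        · simp

/-- Polarisation of a polynomial of degree at most two. -/
theorem eval_add_eq_polar (Q : MvPolynomial (Fin n) (ZMod p)) (hQ : Q.totalDegree ≤ 2)
    (x h : Fin n → ZMod p) :
    eval (x + h) Q = eval x Q + eval h Q - eval 0 Q + x ⬝ᵥ (polarMatrix Q).mulVec h := by
  obtain ⟨M, L, hL, rfl⟩ := exists_eq_quadratic_add Q hQ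
  obtain ⟨ℓ, c, hℓ⟩ := exists_eval_eq_add_const L hL
  have key : ∀ y, eval y ((∑ i, ∑ j, C (M i j) * X i * X j) + L) =
      y ⬝ᵥ M.mulVec y + ℓ y + c := by
    intro y
    rw [map_add, hℓ, ← add_assoc]
    congr 2
    simp only [map_sum, map_mul, eval_C, eval_X, dotProduct, Matrix.mulVec, Finset.mul_sum]
    exact Finset.sum_congr rfl fun i _ => Finset.sum_congr rfl fun j _ => by ring
  have ht : x ⬝ᵥ M.transpose.mulVec h = h ⬝ᵥ M.mulVec x := by
    rw [Matrix.mulVec_transpose, dotProduct_comm, Matrix.dotProduct_mulVec]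
  rw [polarMatrix_eq M L hL, key, key, key, key, Matrix.add_mulVec, Matrix.mulVec_add,
    dotProduct_add, add_dotProduct, add_dotProduct, dotProduct_add, ht, map_add]
  simp
  ring

end Polynomials

/-! ### Linear and quadratic layers of a factor -/

namespace QuadraticFactor

open MvPolynomial

variable {p n D : ℕ}

/-- The linear layer is the partition into the cosets of the common kernel of the linear parts of
the polynomials of degree one. -/
theorem exists_linearLayer_eq (B : QuadraticFactor p n D) :
    ∃ ℓ : {i : Fin D // (B.poly i).totalDegree = 1} → Module.Dual (ZMod p) (Fin n → ZMod p),
      (∀ i x y, eval x (B.poly i.1) = eval y (B.poly i.1) ↔ ℓ i x = ℓ i y) ∧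
      B.linearLayer = (⨅ i, LinearMap.ker (ℓ i)).quotientRel := by
  choose ℓ c h using fun i : {i : Fin D // (B.poly i).totalDegree = 1} =>
    exists_eval_eq_add_const (B.poly i) i.2.le
  refine ⟨ℓ, fun i x y => by rw [h, h, add_left_inj], ?_⟩
  ext x y
  rw [Submodule.quotientRel_def]
  change (∀ i : {i : Fin D // (B.poly i).totalDegree = 1}, _ = _) ↔ _
  simp only [h, add_left_inj, Submodule.mem_iInf, LinearMap.mem_ker, map_sub, sub_eq_zero]

theorem card_linear_add_card_quadratic_le (B : QuadraticFactor p n D) :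
    Fintype.card {i : Fin D // (B.poly i).totalDegree = 1} +
      Fintype.card {i : Fin D // (B.poly i).totalDegree = 2} ≤ D := by
  rw [Fintype.card_subtype, Fintype.card_subtype, ← Finset.card_union_of_disjoint]
  · exact (Finset.card_le_univ _).trans (by simp)
  · rw [Finset.disjoint_filter]
    intro i _ h
    omega

theorem atoms_r_of_eq (B : QuadraticFactor p n D)
    {ℓ : {i : Fin D // (B.poly i).totalDegree = 1} → Module.Dual (ZMod p) (Fin n → ZMod p)}
    (hℓ : ∀ i x y, eval x (B.poly i.1) = eval y (B.poly i.1) ↔ ℓ i x = ℓ i y)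
    {x y : Fin n → ZMod p} (h1 : ∀ i, ℓ i x = ℓ i y)
    (h2 : ∀ i : {i : Fin D // (B.poly i).totalDegree = 2},
      eval x (B.poly i) = eval y (B.poly i)) : B.atoms.r x y := by
  intro i
  have hi := B.degree_le i
  by_cases e1 : (B.poly i).totalDegree = 1
  · exact (hℓ ⟨i, e1⟩ x y).2 (h1 ⟨i, e1⟩)
  · by_cases e2 : (B.poly i).totalDegree = 2
    · exact h2 ⟨i, e2⟩
    · rw [totalDegree_eq_zero_iff_eq_C.1 (by omega : (B.poly i).totalDegree = 0), eval_C, eval_C]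

/-- The exponential sums attached to the quadratic layer of a factor of high rank are small. -/
theorem norm_expect_quadratic_le [Fact p.Prime] (B : QuadraticFactor p n D) {r : ℕ}
    (hr : (r : ℕ∞) ≤ B.rank) (u : {i : Fin D // (B.poly i).totalDegree = 2} → ZMod p)
    (hu : u ≠ 0) (ψ : AddChar (Fin n → ZMod p) ℂ) :
    ‖𝔼 x, (ZMod.stdAddChar (∑ i, u i * eval x (B.poly i)) : ℂ) * ψ x‖ ≤
      √(((p : ℝ) ^ r)⁻¹) := by
  have h1 : (r : ℕ∞) ≤ quadraticRank (∑ i, u i • B.poly i) :=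
    hr.trans ((iInf_le _ u).trans (iInf_le _ hu))
  have h2 : ∀ x, ∑ i, u i * eval x (B.poly i) = eval x (∑ i, u i • B.poly i) := by
    intro x
    simp [smul_eval]
  have h3 : (∑ i, u i • B.poly i).totalDegree ≤ 2 :=
    totalDegree_finsetSum_le fun i _ => (totalDegree_smul_le _ _).trans (B.degree_le i)
  have hp : (1 : ℝ) ≤ p := by exact_mod_cast (Fact.out : p.Prime).one_le
  refine Real.le_sqrt_of_sq_le ?_
  simp only [h2]
  refine (normSq_expect_quadratic_le _ _ (eval_add_eq_polar _ h3) ψ).trans ?_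
  gcongr
  exact_mod_cast h1

/-- A function that is constant on the atoms of a factor of high rank has small correlation with a
function that is, on every coset of the linear layer, a multiple of a non-trivial character. -/
theorem norm_expect_mul_le [Fact p.Prime] (B : QuadraticFactor p n D) {r : ℕ}
    (hr : (r : ℕ∞) ≤ B.rank)
    (ℓ : {i : Fin D // (B.poly i).totalDegree = 1} → Module.Dual (ZMod p) (Fin n → ZMod p))
    (hℓ : ∀ i x y, eval x (B.poly i.1) = eval y (B.poly i.1) ↔ ℓ i x = ℓ i y)
    (G φ : (Fin n → ZMod p) → ℂ) (hG : ∀ x, ‖G x‖ ≤ 1)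
    (hG' : ∀ x y, B.atoms.r x y → G x = G y)
    (hφ : ∀ x, ∃ (c : ℂ) (ψ : AddChar (Fin n → ZMod p) ℂ), ‖c‖ ≤ 1 ∧
      ∀ y, (∀ j, ℓ j y = ℓ j x) → φ y = c * ψ y)
    (hφ0 : ∀ F : (Fin n → ZMod p) → ℂ, (∀ x y, (∀ j, ℓ j x = ℓ j y) → F x = F y) →
      𝔼 x, F x * φ x = 0) :
    ‖𝔼 x, G x * φ x‖ ≤ (p : ℝ) ^ D * √(((p : ℝ) ^ r)⁻¹) := by
  classical
  set ε := √(((p : ℝ) ^ r)⁻¹) with hε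
  have hp : (1 : ℝ) ≤ p := by exact_mod_cast (Fact.out : p.Prime).one_le
  let J₁ := {i : Fin D // (B.poly i).totalDegree = 1}
  let J₂ := {i : Fin D // (B.poly i).totalDegree = 2}
  -- `G` factors through the values of the linear and quadratic polynomials; `0` is a filler for
  -- values that are not attained.
  let g : (J₁ → ZMod p) → (J₂ → ZMod p) → ℂ := fun a b =>
    if h : ∃ y, (∀ j, ℓ j y = a j) ∧ ∀ i : J₂, eval y (B.poly i) = b i then G h.choose else 0
  have hg1 : ∀ a b, ‖g a b‖ ≤ 1 := by
    intro a b
    simp only [g]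
    split_ifs with h
    · exact hG _
    · simp
  have hg : ∀ x, G x = g (fun j => ℓ j x) (fun i : J₂ => eval x (B.poly i)) := by
    intro x
    have h : ∃ y, (∀ j, ℓ j y = ℓ j x) ∧ ∀ i : J₂, eval y (B.poly i) = eval x (B.poly i) :=
      ⟨x, fun _ => rfl, fun _ => rfl⟩
    simp only [g]
    rw [dif_pos h]
    exact (hG' _ _ (B.atoms_r_of_eq hℓ h.choose_spec.1 h.choose_spec.2)).symm
  have h1 : ∀ x, G x = ∑ b : J₂ → ZMod p, g (fun j => ℓ j x) b *
      𝔼 u : J₂ → ZMod p, (ZMod.stdAddChar (∑ i, u i * (eval x (B.poly i) - b i)) : ℂ) := by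
    intro x
    rw [Finset.sum_eq_single fun i : J₂ => eval x (B.poly i)]
    · rw [hg]
      simp
    · intro b _ hb
      rw [expect_stdAddChar_dotProduct (fun i : J₂ => eval x (B.poly i) - b i), if_neg, mul_zero]
      intro h
      exact hb (funext fun j => (sub_eq_zero.1 (congrFun h j)).symm)
    · simp
  have h2 : 𝔼 x, G x * φ x = ∑ b : J₂ → ZMod p, 𝔼 u : J₂ → ZMod p,
      (ZMod.stdAddChar (-∑ i, u i * b i) : ℂ) *
        𝔼 x, (ZMod.stdAddChar (∑ i, u i * eval x (B.poly i)) : ℂ) *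
          (g (fun j => ℓ j x) b * φ x) := by
    simp only [h1, Finset.sum_mul, Finset.mul_expect, Finset.expect_mul]
    rw [Finset.expect_sum_comm]
    refine Finset.sum_congr rfl fun a _ => ?_
    rw [Finset.expect_comm]
    refine Finset.expect_congr rfl fun t _ => Finset.expect_congr rfl fun x _ => ?_
    have h3 : (∑ i, t i * (eval x (B.poly i) - a i)) =
        (-∑ i, t i * a i) + ∑ i, t i * eval x (B.poly i) := by
      simp only [mul_sub, Finset.sum_sub_distrib]
      ring
    rw [h3, AddChar.map_add_eq_mul]
    ring
  rw [h2]
  -- The frequency `u = 0` leaves a function of the linear layer, killed by `hφ0`. Every other `u`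
  -- gives a high-rank phase, small against all characters.
  have h3 : ∀ b u : J₂ → ZMod p, ‖𝔼 x, (ZMod.stdAddChar (∑ i, u i * eval x (B.poly i)) : ℂ) *
      (g (fun j => ℓ j x) b * φ x)‖ ≤ (p : ℝ) ^ Fintype.card J₁ * ε := by
    intro b u
    by_cases hu : u = 0
    · subst hu
      have h4 := hφ0 (fun x => g (fun j => ℓ j x) b) fun x y h => by simp only [h]
      simp only [Pi.zero_apply, zero_mul, Finset.sum_const_zero, AddChar.map_zero_eq_one,
        one_mul, h4, norm_zero]
      positivity
    · refine norm_expect_mul_le_of_piecewise ℓ _ _ _ (B.norm_expect_quadratic_le hr u hu) ?_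
      intro x
      obtain ⟨c, ψ, hc, hψ⟩ := hφ x
      refine ⟨g (fun j => ℓ j x) b * c, ψ, ?_, fun y hy => ?_⟩
      · rw [norm_mul]
        exact mul_le_one₀ (hg1 _ _) (norm_nonneg _) hc
      · simp only [hy, hψ y hy]
        ring
  calc _ ≤ ∑ b : J₂ → ZMod p, (p : ℝ) ^ Fintype.card J₁ * ε := by
        refine norm_sum_le_of_le _ fun b _ => ?_
        refine (RCLike.norm_expect_le (K := ℂ)).trans ?_
        refine Finset.expect_le Finset.univ_nonempty fun u _ => ?_
        rw [norm_mul, AddChar.norm_apply, one_mul]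
        exact h3 b u
    _ = (p : ℝ) ^ (Fintype.card J₁ + Fintype.card J₂) * ε := by
        simp [ZMod.card, pow_add]
        ring
    _ ≤ _ := by
        gcongr
        exact B.card_linear_add_card_quadratic_le

theorem project_eq_of_atoms_r [NeZero p] (B : QuadraticFactor p n D) (f : (Fin n → ZMod p) → ℝ)
    {x y : Fin n → ZMod p} (h : B.atoms.r x y) : B.project f x = B.project f y := by
  unfold project
  congr 1
  ext z
  simp only [Finset.mem_filter, Finset.mem_univ, true_and]
  exact ⟨fun h' => B.atoms.trans (B.atoms.symm h) h', fun h' => B.atoms.trans h h'⟩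

theorem abs_project_le_one [NeZero p] (B : QuadraticFactor p n D) (f : (Fin n → ZMod p) → ℝ)
    (hf : ∀ x, f x ∈ Set.Icc (0 : ℝ) 1) (x : Fin n → ZMod p) : |B.project f x| ≤ 1 := by
  classical
  have hne : (Finset.univ.filter fun y => B.atoms.r x y).Nonempty :=
    ⟨x, by simp⟩
  unfold project
  rw [abs_of_nonneg (Finset.expect_nonneg fun y _ => (hf y).1)]
  convert Finset.expect_le hne fun y _ => (hf y).2

end QuadraticFactor

end QuadReg

namespace QuadReg

/-! ### Separating families from codes -/

section Codes

variable {p : ℕ} [Fact p.Prime]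

/-- Since `σ` is surjective, translating its argument by any `a` does not change the left average;
averaging over `a` and swapping the averages gives the right side. -/
theorem expect_comp_surjective {V A M : Type*} [Fintype V] [Fintype A] [AddCommGroup V]
    [AddCommGroup A] [AddCommMonoid M] [Module ℚ≥0 M] (σ : V →+ A) (hσ : Function.Surjective σ)
    (F : A → M) : 𝔼 x, F (σ x) = 𝔼 a, F a := by
  have h1 : ∀ a, 𝔼 x, F (σ x + a) = 𝔼 x, F (σ x) := by
    intro a
    obtain ⟨y, rfl⟩ := hσ a
    simp only [← map_add]
    exact expect_comp_add_right (fun x => F (σ x)) y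
  have h2 : ∀ x, 𝔼 a, F (σ x + a) = 𝔼 a, F a := fun x =>
    Fintype.expect_equiv (Equiv.addLeft (σ x)) _ _ fun _ => rfl
  calc 𝔼 x, F (σ x) = 𝔼 a, 𝔼 x, F (σ x + a) := by
        simp only [h1]
        rw [Fintype.expect_const]
    _ = 𝔼 x, 𝔼 a, F (σ x + a) := Finset.expect_comm _ _ _
    _ = 𝔼 a, F a := by
        simp only [h2]
        rw [Fintype.expect_const]

/-- A family of non-zero functionals on `T`, indexed by `A`, such that every non-zero vector is
missed by at least a quarter of their kernels. -/
structure IsSeparatingFamily {A T : Type} [Fintype A] [AddCommGroup T] [Module (ZMod p) T]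
    (η : A → Module.Dual (ZMod p) T) : Prop where
  ne_zero : ∀ a, η a ≠ 0
  quarter_le : ∀ w ≠ 0, (1 / 4 : ℝ) ≤ 𝔼 a, if η a w ≠ 0 then 1 else 0

theorem half_le_expect_ne_zero {V : Type*} [Fintype V] [AddCommGroup V] [Module (ZMod p) V]
    (ℓ : Module.Dual (ZMod p) V) (hℓ : ℓ ≠ 0) :
    (1 / 2 : ℝ) ≤ 𝔼 x, if ℓ x ≠ 0 then 1 else 0 := by
  have h1 := expect_comp_surjective ℓ.toAddMonoidHom (LinearMap.surjective hℓ)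
    fun t : ZMod p => if t ≠ 0 then (1 : ℝ) else 0
  simp only [LinearMap.toAddMonoidHom_coe] at h1
  have hp : (2 : ℝ) ≤ p := by exact_mod_cast (Fact.out : p.Prime).two_le
  have h2 : ((Finset.univ.filter fun t : ZMod p => t ≠ 0).card : ℝ) = p - 1 := by
    rw [Finset.filter_ne', Finset.card_erase_of_mem (Finset.mem_univ _), Finset.card_univ,
      ZMod.card, Nat.cast_sub (by exact_mod_cast (Fact.out : p.Prime).one_le), Nat.cast_one]
  refine le_of_le_of_eq ?_ h1.symm
  rw [Fintype.expect_eq_sum_div_card, Finset.sum_boole, h2, ZMod.card,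
    div_le_div_iff₀ (by norm_num) (by linarith)]
  linarith

/-- The one-point index set needs no codimension at all, so this family can start the chain. -/
theorem isSeparatingFamily_id :
    IsSeparatingFamily (fun _ : Fin 0 → ZMod p => (LinearMap.id : Module.Dual (ZMod p) (ZMod p))) where
  ne_zero _ h := one_ne_zero (DFunLike.congr_fun h (1 : ZMod p))
  quarter_le w hw := by
    rw [Fintype.expect_const]
    simp only [LinearMap.id_apply, if_pos hw]
    norm_num

theorem half_le_expect_eval_ne_zero {K : Type*} [Field K] [Fintype K] [DecidableEq K] {k : ℕ}
    (hk : 2 * k ≤ Fintype.card K) (P : Polynomial K) (hP : P ≠ 0) (hdeg : P.natDegree < k) :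
    (1 / 2 : ℝ) ≤ 𝔼 a, if P.eval a ≠ 0 then 1 else 0 := by
  have h1 : (Finset.univ.filter fun a => P.eval a = 0).card ≤ P.natDegree := by
    refine Polynomial.card_le_degree_of_subset_roots fun a ha => ?_
    rw [Polynomial.mem_roots hP]
    simpa using ha
  have h2 := Finset.card_filter_add_card_filter_not (s := Finset.univ) fun a : K => P.eval a = 0
  rw [Finset.card_univ] at h2
  have h3 : Fintype.card K ≤ 2 * (Finset.univ.filter fun a => ¬ P.eval a = 0).card := by omega
  have h4 : (0 : ℝ) < Fintype.card K := by exact_mod_cast Fintype.card_pos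
  have h5 : (Fintype.card K : ℝ) ≤ 2 * (Finset.univ.filter fun a => ¬ P.eval a = 0).card := by
    exact_mod_cast h3
  rw [Fintype.expect_eq_sum_div_card, Finset.sum_boole, div_le_div_iff₀ (by norm_num) h4]
  linarith

/-- The Reed–Solomon code over a finite field, concatenated with the Hadamard code. -/
theorem exists_isSeparatingFamily {K : Type} [Field K] [Fintype K] [Algebra (ZMod p) K] {k : ℕ}
    (hk0 : 1 ≤ k) (hk : 2 * k ≤ Fintype.card K) :
    ∃ η : K × K → Module.Dual (ZMod p) (Fin k → K), IsSeparatingFamily η := by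
  classical
  obtain ⟨l, hl⟩ := Module.Projective.exists_dual_ne_zero (ZMod p) (one_ne_zero (α := K))
  let ev : K → (Fin k → K) →ₗ[K] K := fun a => (Polynomial.leval a).comp (Polynomial.ofFn k)
  let η₀ : K × K → Module.Dual (ZMod p) (Fin k → K) := fun x =>
    l.comp ((x.2 • ev x.1).restrictScalars (ZMod p))
  have : Nontrivial (Fin k → K) := by
    have : Nonempty (Fin k) := ⟨⟨0, hk0⟩⟩
    infer_instance
  obtain ⟨w₀, hw₀⟩ := exists_ne (0 : Fin k → K)
  obtain ⟨m, hm⟩ := Module.Projective.exists_dual_ne_zero (ZMod p) hw₀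
  -- `η₀ x` is zero for instance when `x.2 = 0`. Putting a fixed non-zero `m` there can only enlarge
  -- the set where the value at `w` is non-zero.
  refine ⟨fun x => if η₀ x = 0 then m else η₀ x, fun x => ?_, fun w hw => ?_⟩
  · split_ifs with h
    · rintro rfl
      exact hm rfl
    · exact h
  · have hP : Polynomial.ofFn k w ≠ 0 := fun h =>
      hw (Polynomial.injective_ofFn k (by rw [h, map_zero]))
    have hP' : (Polynomial.ofFn k w).natDegree < k := Polynomial.ofFn_natDegree_lt hk0 w
    have h1 : (1 / 4 : ℝ) ≤ 𝔼 x : K × K, if η₀ x w ≠ 0 then 1 else 0 := by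
      rw [← Finset.univ_product_univ, Finset.expect_product]
      -- Half of the points `a` are not roots of the polynomial of `w` (Reed–Solomon); for each of
      -- these, half of the multipliers `b` give a non-zero value of `l` (Hadamard).
      calc (1 / 4 : ℝ) = (1 / 2) * (1 / 2) := by norm_num
        _ ≤ (𝔼 a, if (Polynomial.ofFn k w).eval a ≠ 0 then 1 else 0) * (1 / 2) := by
          gcongr
          exact half_le_expect_eval_ne_zero hk _ hP hP'
        _ ≤ _ := by
          rw [Finset.expect_mul]
          refine Finset.expect_le_expect fun a _ => ?_
          split_ifs with ha
          · have h2 := half_le_expect_ne_zero (p := p)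
              (l.comp (((LinearMap.toSpanSingleton K K ((Polynomial.ofFn k w).eval a))).restrictScalars
                (ZMod p))) ?_
            · rw [one_mul]
              exact h2
            · intro h
              have h3 := DFunLike.congr_fun h ((Polynomial.ofFn k w).eval a)⁻¹
              simp [inv_mul_cancel₀ ha] at h3
              exact hl h3
          · rw [zero_mul]
            exact Finset.expect_nonneg fun _ _ => by split_ifs <;> norm_num
    refine h1.trans (Finset.expect_le_expect fun x _ => ?_)
    by_cases hx : η₀ x = 0
    · rw [hx]
      simp only [LinearMap.zero_apply, ne_eq, not_true_eq_false, if_false]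
      split_ifs <;> norm_num
    · simp only [hx, if_false, le_refl]

end Codes

/-! ### Chains of subspaces with tower-type codimension -/

section Chains

variable {p : ℕ} [Fact p.Prime] {V : Type} [Fintype V] [AddCommGroup V] [Module (ZMod p) V]

/-- A refinement of the partition into cosets of `W` to the one into cosets of `W'`, governed by a
functional `ξ x` for every coset `x + W`. -/
structure IsRefinementStep (W W' : Submodule (ZMod p) V) (ξ : V → Module.Dual (ZMod p) V) :
    Prop where
  le : W' ≤ W
  apply_add : ∀ x, ∀ w ∈ W, ξ (x + w) = ξ x
  apply_eq_zero : ∀ x, ∀ w ∈ W', ξ x w = 0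
  exists_ne_zero : ∀ x, ∃ w ∈ W, ξ x w ≠ 0
  quarter_le : ∀ v ∈ W, v ∉ W' → (1 / 4 : ℝ) ≤ 𝔼 x, if ξ x v ≠ 0 then 1 else 0

/-- The map `σ` kills `W` and so labels its cosets by code positions, while `τ` reads a vector of
`W` as a message. Surjectivity of `σ` makes the positions equidistributed. -/
theorem IsSeparatingFamily.isRefinementStep {A T : Type} [Fintype A] [AddCommGroup A]
    [Module (ZMod p) A] [AddCommGroup T] [Module (ZMod p) T] {η : A → Module.Dual (ZMod p) T}
    (hη : IsSeparatingFamily η) {W : Submodule (ZMod p) V} (σ : V →ₗ[ZMod p] A)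
    (hσ : Function.Surjective σ) (hσW : W ≤ LinearMap.ker σ) (τ : V →ₗ[ZMod p] T)
    (hτ : Function.Surjective (τ.domRestrict W)) :
    IsRefinementStep W (W ⊓ LinearMap.ker τ) fun x => (η (σ x)).comp τ where
  le := inf_le_left
  apply_add x w hw := by rw [map_add, LinearMap.mem_ker.1 (hσW hw), add_zero]
  apply_eq_zero x w hw := by rw [LinearMap.comp_apply, LinearMap.mem_ker.1 hw.2, map_zero]
  exists_ne_zero x := by
    obtain ⟨t, ht⟩ := DFunLike.ne_iff.1 (hη.ne_zero (σ x))
    obtain ⟨w, rfl⟩ := hτ t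
    exact ⟨w, w.2, ht⟩
  quarter_le v hv hv' := by
    have h1 : τ v ≠ 0 := fun h => hv' ⟨hv, h⟩
    refine (hη.quarter_le _ h1).trans (le_of_eq ?_)
    exact (expect_comp_surjective σ.toAddMonoidHom hσ
      fun a => if η a (τ v) ≠ 0 then (1 : ℝ) else 0).symm

theorem exists_surjective_of_finrank_le {A B : Type*} [AddCommGroup A] [AddCommGroup B]
    [Module (ZMod p) A] [Module (ZMod p) B] [Module.Finite (ZMod p) A] [Module.Finite (ZMod p) B]
    (h : Module.finrank (ZMod p) B ≤ Module.finrank (ZMod p) A) :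
    ∃ f : A →ₗ[ZMod p] B, Function.Surjective f := by
  obtain ⟨g, hg⟩ := finrank_le_iff_exists_linearMap.1 h
  obtain ⟨f, hf⟩ := g.exists_leftInverse_of_injective (LinearMap.ker_eq_bot.2 hg)
  exact ⟨f, fun b => ⟨g b, DFunLike.congr_fun hf b⟩⟩

theorem IsSeparatingFamily.exists_isRefinementStep {A T : Type} [Fintype A] [AddCommGroup A]
    [Module (ZMod p) A] [AddCommGroup T] [Module (ZMod p) T] [Module.Finite (ZMod p) T]
    {η : A → Module.Dual (ZMod p) T} (hη : IsSeparatingFamily η) (W : Submodule (ZMod p) V)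
    (hA : Module.finrank (ZMod p) A ≤ Module.finrank (ZMod p) (V ⧸ W))
    (hT : Module.finrank (ZMod p) T ≤ Module.finrank (ZMod p) W) :
    ∃ W' ξ, IsRefinementStep W W' ξ ∧ Module.finrank (ZMod p) (V ⧸ W') =
      Module.finrank (ZMod p) (V ⧸ W) + Module.finrank (ZMod p) T := by
  obtain ⟨σ, hσ⟩ := exists_surjective_of_finrank_le hA
  obtain ⟨τ₀, hτ₀⟩ := exists_surjective_of_finrank_le hT
  -- The functionals must live on all of `V`, so the surjection from `W` is extended.
  obtain ⟨τ, rfl⟩ := τ₀.exists_extend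
  refine ⟨W ⊓ LinearMap.ker τ, _, hη.isRefinementStep (σ.comp W.mkQ)
    (hσ.comp W.mkQ_surjective) ?_ τ hτ₀, ?_⟩
  · intro w hw
    rw [LinearMap.mem_ker, LinearMap.comp_apply, Submodule.mkQ_apply, (Submodule.Quotient.mk_eq_zero W).2 hw, map_zero]
  · have h1 := LinearMap.finrank_range_add_finrank_ker (τ.domRestrict W)
    have h2 : LinearMap.range (τ.domRestrict W) = ⊤ := LinearMap.range_eq_top.2 hτ₀
    have h3 : Module.finrank (ZMod p) (LinearMap.ker (τ.domRestrict W)) =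
        Module.finrank (ZMod p) (W ⊓ LinearMap.ker τ : Submodule (ZMod p) V) := by
      rw [LinearMap.ker_domRestrict, ← Submodule.map_comap_subtype]
      exact (LinearEquiv.finrank_eq (Submodule.equivMapOfInjective _ W.subtype_injective _))
    rw [h2, finrank_top, h3] at h1
    have h4 := (W ⊓ LinearMap.ker τ).finrank_quotient_add_finrank
    have h5 := W.finrank_quotient_add_finrank
    omega

/-- The number of new dimensions gained by a refinement step starting from codimension `D`. -/
def stepGain (D : ℕ) : ℕ := if D < 2 then 1 else D / 2 * 2 ^ (D / 2 - 1)

theorem exists_isRefinementStep (W : Submodule (ZMod p) V)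
    (h : stepGain (Module.finrank (ZMod p) (V ⧸ W)) ≤ Module.finrank (ZMod p) W) :
    ∃ W' ξ, IsRefinementStep W W' ξ ∧ Module.finrank (ZMod p) (V ⧸ W') =
      Module.finrank (ZMod p) (V ⧸ W) + stepGain (Module.finrank (ZMod p) (V ⧸ W)) := by
  set D := Module.finrank (ZMod p) (V ⧸ W)
  by_cases hD : D < 2
  · rw [stepGain, if_pos hD] at h ⊢
    have := (isSeparatingFamily_id (p := p)).exists_isRefinementStep W (by simp) (by simpa using h)
    simpa using this
  · rw [stepGain, if_neg hD] at h ⊢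
    -- The index space `K × K` has dimension `2 * m`, which must not exceed `D`; the message length
    -- `2 ^ (m - 1)` is at most half of `p ^ m`.
    set m := D / 2
    have hm : m ≠ 0 := by omega
    let K := GaloisField p m
    let _ : Fintype K := Fintype.ofFinite K
    have hK : Fintype.card K = p ^ m := by rw [← Nat.card_eq_fintype_card, GaloisField.card p m hm]
    have hk : 2 * 2 ^ (m - 1) ≤ Fintype.card K := by
      rw [hK, ← pow_succ', Nat.sub_add_cancel (by omega)]
      exact Nat.pow_le_pow_left (Fact.out : p.Prime).two_le m
    obtain ⟨η, hη⟩ := exists_isSeparatingFamily (p := p) (K := K) Nat.one_le_two_pow hk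
    have hT : Module.finrank (ZMod p) (Fin (2 ^ (m - 1)) → K) = m * 2 ^ (m - 1) := by
      rw [Module.finrank_pi_fintype]
      simp [K, GaloisField.finrank p hm, mul_comm]
    rw [← hT] at h ⊢
    refine hη.exists_isRefinementStep W ?_ h
    rw [Module.finrank_prod, GaloisField.finrank p hm]
    omega

/-- The codimension reached after `s` refinement steps. -/
def chainCodim (s : ℕ) : ℕ := (fun D => D + stepGain D)^[s] 0

theorem chainCodim_succ (s : ℕ) : chainCodim (s + 1) = chainCodim s + stepGain (chainCodim s) := by
  rw [chainCodim, Function.iterate_succ_apply']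
  rfl

theorem chainCodim_mono : Monotone chainCodim :=
  monotone_nat_of_le_succ fun s => by rw [chainCodim_succ]; exact Nat.le_add_right _ _

theorem one_le_twr (i : ℕ) : 1 ≤ twr i := by
  cases i with
  | zero => exact le_rfl
  | succ i => exact Nat.one_le_two_pow

/-- The invariant is chosen so that `D / 2 - 1 ≥ twr i`, which offsets both the halving and the `-
1` in the exponent of `stepGain`. The codimensions begin 0, 1, 2, 3, 4, so four preliminary steps
reach `2 * (twr 0 + 1)`. -/
theorem two_mul_twr_le_chainCodim (i : ℕ) : 2 * (twr i + 1) ≤ chainCodim (4 + i) := by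
  induction i with
  | zero => decide
  | succ i ih =>
    have hT := one_le_twr i
    rw [← add_assoc, chainCodim_succ, stepGain, if_neg (by omega)]
    set D := chainCodim (4 + i)
    have hm : twr i + 1 ≤ D / 2 := by omega
    have h1 : 2 * 2 ^ twr i ≤ D / 2 * 2 ^ (D / 2 - 1) :=
      Nat.mul_le_mul (by omega) (Nat.pow_le_pow_right (by norm_num) (by omega))
    rw [twr]
    omega

theorem exists_refinement_chain (s : ℕ) (hs : chainCodim s ≤ Module.finrank (ZMod p) V) :
    ∃ (W : ℕ → Submodule (ZMod p) V) (ξ : ℕ → V → Module.Dual (ZMod p) V), W 0 = ⊤ ∧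
      (∀ i < s, IsRefinementStep (W i) (W (i + 1)) (ξ i)) ∧
      Module.finrank (ZMod p) (V ⧸ W s) = chainCodim s := by
  -- Making the room condition a premise gives a step function on all subspaces, which can be
  -- iterated; the filler used without room is never reached below `s`.
  have h : ∀ W : Submodule (ZMod p) V, ∃ q : Submodule (ZMod p) V × (V → Module.Dual (ZMod p) V),
      stepGain (Module.finrank (ZMod p) (V ⧸ W)) ≤ Module.finrank (ZMod p) W →
        IsRefinementStep W q.1 q.2 ∧ Module.finrank (ZMod p) (V ⧸ q.1) =
          Module.finrank (ZMod p) (V ⧸ W) + stepGain (Module.finrank (ZMod p) (V ⧸ W)) := by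
    intro W
    by_cases hW : stepGain (Module.finrank (ZMod p) (V ⧸ W)) ≤ Module.finrank (ZMod p) W
    · obtain ⟨W', ξ, h⟩ := exists_isRefinementStep W hW
      exact ⟨(W', ξ), fun _ => h⟩
    · exact ⟨(W, 0), fun h => (hW h).elim⟩
  choose q hq using h
  let W : ℕ → Submodule (ZMod p) V := fun i => (fun W => (q W).1)^[i] ⊤
  have hWs : ∀ i, W (i + 1) = (q (W i)).1 := fun i => Function.iterate_succ_apply' _ _ _
  have room : ∀ i < s, Module.finrank (ZMod p) (V ⧸ W i) = chainCodim i →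
      stepGain (Module.finrank (ZMod p) (V ⧸ W i)) ≤ Module.finrank (ZMod p) (W i) := by
    intro i hi h
    have h1 : chainCodim (i + 1) ≤ chainCodim s := chainCodim_mono hi
    rw [chainCodim_succ] at h1
    have h2 := (W i).finrank_quotient_add_finrank
    rw [h] at h2 ⊢
    omega
  have hcodim : ∀ i ≤ s, Module.finrank (ZMod p) (V ⧸ W i) = chainCodim i := by
    intro i
    induction i with
    | zero =>
      intro _
      have h1 := (⊤ : Submodule (ZMod p) V).finrank_quotient_add_finrank
      rw [finrank_top] at h1
      change Module.finrank (ZMod p) (V ⧸ (⊤ : Submodule (ZMod p) V)) = 0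
      omega
    | succ i ih =>
      intro hi
      have h1 := ih (by omega)
      rw [hWs, (hq _ (room i hi h1)).2, chainCodim_succ, h1]
  refine ⟨W, fun i => (q (W i)).2, rfl, fun i hi => ?_, hcodim s le_rfl⟩
  rw [hWs]
  exact (hq _ (room i hi (hcodim i hi.le))).1

end Chains

end QuadReg

namespace QuadReg

/-! ### Correlation of the chain function with truncated phases -/

section Correlation

variable {p : ℕ} [Fact p.Prime] {V : Type} [AddCommGroup V] [Module (ZMod p) V]

/-- The indicator function of the hyperplanes cut out by the functionals `ξ x`. -/
noncomputable def hyperplaneIndicator (ξ : V → Module.Dual (ZMod p) V) (x : V) : ℝ :=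
  if ξ x x = 0 then 1 else 0

/-- The phase `e(ξ x x)`, restricted to the points `x` at which `ξ x` does not vanish on `v`. -/
noncomputable def truncatedPhase (ξ : V → Module.Dual (ZMod p) V) (v x : V) : ℂ :=
  if ξ x v ≠ 0 then ZMod.stdAddChar (ξ x x) else 0

theorem norm_truncatedPhase_le (ξ : V → Module.Dual (ZMod p) V) (v x : V) :
    ‖truncatedPhase ξ v x‖ ≤ 1 := by
  unfold truncatedPhase
  split_ifs <;> simp

/-- The average of the hyperplane indicators of the steps of a refinement chain. -/
noncomputable def chainFunction (N : ℕ) (ξ : ℕ → V → Module.Dual (ZMod p) V) (x : V) : ℝ :=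
  (N : ℝ)⁻¹ * ∑ j ∈ Finset.range N, hyperplaneIndicator (ξ j) x

theorem chainFunction_mem_Icc (N : ℕ) (ξ : ℕ → V → Module.Dual (ZMod p) V) (x : V) :
    chainFunction N ξ x ∈ Set.Icc (0 : ℝ) 1 := by
  have h1 : ∀ j, hyperplaneIndicator (ξ j) x ∈ Set.Icc (0 : ℝ) 1 := by
    intro j
    unfold hyperplaneIndicator
    split_ifs <;> simp
  refine ⟨mul_nonneg (by positivity) (Finset.sum_nonneg fun j _ => (h1 j).1), ?_⟩
  have h2 : ∑ j ∈ Finset.range N, hyperplaneIndicator (ξ j) x ≤ N := by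
    simpa using Finset.sum_le_card_nsmul (Finset.range N) _ 1 fun j _ => (h1 j).2
  exact (mul_le_mul_of_nonneg_left h2 (by positivity)).trans (inv_mul_le_one)

variable [Fintype V]

namespace IsRefinementStep

variable {W W' : Submodule (ZMod p) V} {ξ : V → Module.Dual (ZMod p) V}

/-- As `ξ` is constant on `x + W`, the expression `ξ x x`, though not linear in `x`, is affine on
each coset of `W`. -/
theorem apply_add_self (h : IsRefinementStep W W' ξ) (x : V) {w : V} (hw : w ∈ W) :
    ξ (x + w) (x + w) = ξ x x + ξ x w := by
  rw [h.apply_add x w hw, map_add]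

theorem hyperplaneIndicator_add (h : IsRefinementStep W W' ξ) (x : V) {w : V} (hw : w ∈ W') :
    hyperplaneIndicator ξ (x + w) = hyperplaneIndicator ξ x := by
  rw [hyperplaneIndicator, hyperplaneIndicator, h.apply_add_self x (h.le hw),
    h.apply_eq_zero x w hw, add_zero]

theorem truncatedPhase_add (h : IsRefinementStep W W' ξ) (v x : V) {w : V} (hw : w ∈ W') :
    truncatedPhase ξ v (x + w) = truncatedPhase ξ v x := by
  rw [truncatedPhase, truncatedPhase, h.apply_add_self x (h.le hw), h.apply_eq_zero x w hw,
    add_zero, h.apply_add x w (h.le hw)]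

/-- The truncated phase is orthogonal to all functions that are invariant under `v`. -/
theorem expect_mul_truncatedPhase_eq_zero (h : IsRefinementStep W W' ξ) {v : V} (hv : v ∈ W)
    (F : V → ℂ) (hF : ∀ x (t : ZMod p), F (x + t • v) = F x) :
    𝔼 x, F x * truncatedPhase ξ v x = 0 := by
  -- Along the line `x + t • v` the phase runs through the character `t ↦ e(t ξ x v)`, which is
  -- non-trivial wherever the truncation does not remove the point.
  have h1 : ∀ x, 𝔼 t : ZMod p, truncatedPhase ξ v (x + t • v) = 0 := by
    intro x
    have h2 : ∀ t : ZMod p, truncatedPhase ξ v (x + t • v) = truncatedPhase ξ v x *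
        linChar (LinearMap.toSpanSingleton (ZMod p) (ZMod p) (ξ x v)) t := by
      intro t
      rw [truncatedPhase, truncatedPhase, h.apply_add_self x (W.smul_mem t hv),
        h.apply_add x _ (W.smul_mem t hv), map_smul, AddChar.map_add_eq_mul, ite_mul, zero_mul]
      rfl
    simp only [h2]
    rw [← Finset.mul_expect]
    by_cases h3 : ξ x v = 0
    · rw [truncatedPhase, if_neg (not_not.2 h3), zero_mul]
    · rw [expect_linChar, if_neg, mul_zero]
      exact fun h0 => h3 (by simpa using DFunLike.congr_fun h0 1)
  calc 𝔼 x, F x * truncatedPhase ξ v x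
      = 𝔼 t : ZMod p, 𝔼 x, F (x + t • v) * truncatedPhase ξ v (x + t • v) := by
        simp only [expect_comp_add_right (fun x => F x * truncatedPhase ξ v x)]
        rw [Fintype.expect_const]
    _ = 𝔼 x, F x * 𝔼 t : ZMod p, truncatedPhase ξ v (x + t • v) := by
        rw [Finset.expect_comm]
        simp only [hF, Finset.mul_expect]
    _ = 0 := by simp [h1]

/-- The hyperplane indicator is balanced on every coset of `W`. -/
theorem expect_hyperplaneIndicator_mul (h : IsRefinementStep W W' ξ) (F : V → ℂ)
    (hF : ∀ x, ∀ w ∈ W, F (x + w) = F x) :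
    𝔼 x, (hyperplaneIndicator ξ x : ℂ) * F x = (p : ℂ)⁻¹ * 𝔼 x, F x := by
  classical
  -- `ξ x` is non-zero on `W`, so it takes the value `-ξ x x` with frequency exactly `1 / p`.
  have h1 : ∀ x, 𝔼 w : W, (hyperplaneIndicator ξ (x + w) : ℂ) = (p : ℂ)⁻¹ := by
    intro x
    obtain ⟨w₀, hw₀, hx⟩ := h.exists_ne_zero x
    have hs : Function.Surjective ((ξ x).domRestrict W) :=
      LinearMap.surjective fun h0 => hx (DFunLike.congr_fun h0 ⟨w₀, hw₀⟩)
    have h2 := expect_comp_surjective ((ξ x).domRestrict W).toAddMonoidHom hs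
      fun t : ZMod p => if t = -ξ x x then (1 : ℂ) else 0
    rw [Fintype.expect_ite_eq', ZMod.card] at h2
    have h3 : (p : ℂ)⁻¹ = (p : ℚ≥0)⁻¹ • (1 : ℂ) := by
      rw [NNRat.smul_def]
      simp
    rw [h3, ← h2]
    refine Finset.expect_congr rfl fun w _ => ?_
    rw [hyperplaneIndicator, h.apply_add_self x w.2]
    simp only [LinearMap.toAddMonoidHom_coe, LinearMap.domRestrict_apply, eq_neg_iff_add_eq_zero,
      add_comm (ξ x x)]
    split_ifs <;> simp
  calc 𝔼 x, (hyperplaneIndicator ξ x : ℂ) * F x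
      = 𝔼 w : W, 𝔼 x, (hyperplaneIndicator ξ (x + w) : ℂ) * F (x + w) := by
        simp only [expect_comp_add_right (fun x => (hyperplaneIndicator ξ x : ℂ) * F x)]
        rw [Fintype.expect_const]
    _ = 𝔼 x, (𝔼 w : W, (hyperplaneIndicator ξ (x + w) : ℂ)) * F x := by
        rw [Finset.expect_comm]
        simp only [hF _ _ (Subtype.coe_prop _), Finset.expect_mul]
    _ = _ := by simp only [h1, Finset.mul_expect]

/-- Where the indicator is non-zero the phase equals 1, so only the truncation remains; it is
invariant under `W`, and the balance of the indicator applies. -/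
theorem expect_hyperplaneIndicator_mul_truncatedPhase (h : IsRefinementStep W W' ξ) (v : V) :
    𝔼 x, (hyperplaneIndicator ξ x : ℂ) * truncatedPhase ξ v x =
      (p : ℂ)⁻¹ * ((𝔼 x, if ξ x v ≠ 0 then 1 else 0 : ℝ) : ℂ) := by
  have h1 := h.expect_hyperplaneIndicator_mul (fun x => if ξ x v ≠ 0 then 1 else 0)
    fun x w hw => by rw [h.apply_add x w hw]
  have h2 : ((𝔼 x, if ξ x v ≠ 0 then 1 else 0 : ℝ) : ℂ) = 𝔼 x, if ξ x v ≠ 0 then (1 : ℂ) else 0 := by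
    rw [Fintype.expect_eq_sum_div_card, Fintype.expect_eq_sum_div_card]
    push_cast
    congr 1
    exact Finset.sum_congr rfl fun x _ => by split_ifs <;> simp
  rw [h2, ← h1]
  refine Finset.expect_congr rfl fun x _ => ?_
  rw [hyperplaneIndicator, truncatedPhase]
  by_cases h3 : ξ x x = 0
  · simp [h3]
  · simp [h3]

end IsRefinementStep

/-- A single step of the chain correlates with the average over all steps. -/
theorem le_norm_expect_chainFunction_mul {N : ℕ} {W : ℕ → Submodule (ZMod p) V}
    {ξ : ℕ → V → Module.Dual (ZMod p) V}
    (hW : ∀ j < N, IsRefinementStep (W j) (W (j + 1)) (ξ j)) {i : ℕ} (hi : i < N) {v : V}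
    (hv : v ∈ W i) (hv' : v ∉ W (i + 1)) :
    (4 * p * N : ℝ)⁻¹ ≤ ‖𝔼 x, (chainFunction N ξ x : ℂ) * truncatedPhase (ξ i) v x‖ := by
  have hanti : ∀ {j k}, j ≤ k → k ≤ N → W k ≤ W j := by
    intro j k hjk
    induction k, hjk using Nat.le_induction with
    | base => exact fun _ => le_rfl
    | succ k _ ih => exact fun hk => (hW k hk).le.trans (ih (by omega))
  set P : ℝ := 𝔼 x, if ξ i x v ≠ 0 then 1 else 0 with hP
  have hP4 : (1 / 4 : ℝ) ≤ P := (hW i hi).quarter_le v hv hv'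
  have h1 : ∀ j ∈ Finset.range N, j ≠ i →
      𝔼 x, (hyperplaneIndicator (ξ j) x : ℂ) * truncatedPhase (ξ i) v x = 0 := by
    intro j hj hji
    rw [Finset.mem_range] at hj
    -- For `j < i` the indicator is invariant under `v`, along which the phase averages to zero. For
    -- `j > i` the phase is constant on cosets of `W j`, where the indicator is balanced, so what is
    -- left is the zero mean of the phase.
    rcases lt_or_gt_of_ne hji with hlt | hgt
    · refine (hW i hi).expect_mul_truncatedPhase_eq_zero hv _ fun x t => ?_
      rw [(hW j hj).hyperplaneIndicator_add x ((W (j + 1)).smul_mem t (hanti hlt hi.le hv))]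
    · rw [(hW j hj).expect_hyperplaneIndicator_mul _ fun x w hw =>
        (hW i hi).truncatedPhase_add v x (hanti hgt hj.le hw)]
      have h2 := (hW i hi).expect_mul_truncatedPhase_eq_zero hv (fun _ => 1) fun _ _ => rfl
      simp only [one_mul] at h2
      rw [h2, mul_zero]
  have h2 : 𝔼 x, (chainFunction N ξ x : ℂ) * truncatedPhase (ξ i) v x =
      (((N : ℝ)⁻¹ * ((p : ℝ)⁻¹ * P) : ℝ) : ℂ) := by
    have h3 : ∀ x, (chainFunction N ξ x : ℂ) * truncatedPhase (ξ i) v x = (N : ℂ)⁻¹ *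
        ∑ j ∈ Finset.range N, (hyperplaneIndicator (ξ j) x : ℂ) * truncatedPhase (ξ i) v x := by
      intro x
      rw [chainFunction, ← Finset.sum_mul]
      push_cast
      ring
    simp only [h3]
    rw [← Finset.mul_expect, Finset.expect_sum_comm,
      Finset.sum_eq_single_of_mem i (Finset.mem_range.2 hi) h1,
      (hW i hi).expect_hyperplaneIndicator_mul_truncatedPhase v, ← hP, Complex.ofReal_mul,
      Complex.ofReal_mul, Complex.ofReal_inv, Complex.ofReal_inv, Complex.ofReal_natCast,
      Complex.ofReal_natCast]
  have hp : (0 : ℝ) < p := by exact_mod_cast (Fact.out : p.Prime).pos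
  have hN : (0 : ℝ) < N := by exact_mod_cast (by omega : 0 < N)
  rw [h2, Complex.norm_real, Real.norm_of_nonneg (by positivity)]
  calc (4 * p * N : ℝ)⁻¹ = (N : ℝ)⁻¹ * ((p : ℝ)⁻¹ * (1 / 4)) := by
        field_simp
    _ ≤ _ := by gcongr

end Correlation

/-! ### Regularity partitions refine the chain -/

section Regularity

variable {p : ℕ} [Fact p.Prime] {n D : ℕ}

theorem norm_expect_mul_le_l2Norm {V : Type} [Fintype V] [Nonempty V] (g : V → ℝ) (φ : V → ℂ)
    (hφ : ∀ x, ‖φ x‖ ≤ 1) : ‖𝔼 x, (g x : ℂ) * φ x‖ ≤ l2Norm g := by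
  refine Real.le_sqrt_of_sq_le ?_
  calc ‖𝔼 x, (g x : ℂ) * φ x‖ ^ 2 ≤ (𝔼 x, |g x|) ^ 2 := by
        gcongr
        refine (RCLike.norm_expect_le (K := ℂ)).trans (Finset.expect_le_expect fun x _ => ?_)
        rw [norm_mul, Complex.norm_real, Real.norm_eq_abs]
        exact mul_le_of_le_one_right (abs_nonneg _) (hφ x)
    _ ≤ 𝔼 x, |g x| ^ 2 := sq_expect_le _
    _ = 𝔼 x, g x ^ 2 := by simp only [sq_abs]

/-- If `B` is a quadratic regularity partition for the average of a refinement chain, with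
good enough parameters, then its linear layer refines the whole chain. -/
theorem iInf_ker_le_of_isQuadraticRegularityPartition {N : ℕ}
    {W : ℕ → Submodule (ZMod p) (Fin n → ZMod p)}
    {ξ : ℕ → (Fin n → ZMod p) → Module.Dual (ZMod p) (Fin n → ZMod p)} (hW0 : W 0 = ⊤)
    (hW : ∀ j < N, IsRefinementStep (W j) (W (j + 1)) (ξ j)) {δ : ℝ} {ω R : ℕ → ℕ}
    (B : QuadraticFactor p n D)
    (hB : IsQuadraticRegularityPartition δ ω R (chainFunction N ξ) B)
    (hδ : (p : ℝ) ^ D * √(((p : ℝ) ^ R D)⁻¹) + δ + (p : ℝ) ^ D * (1 / (ω D : ℝ)) ≤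
      (4 * p * N : ℝ)⁻¹)
    (ℓ : {i : Fin D // (B.poly i).totalDegree = 1} → Module.Dual (ZMod p) (Fin n → ZMod p))
    (hℓ : ∀ i x y, MvPolynomial.eval x (B.poly i.1) = MvPolynomial.eval y (B.poly i.1) ↔
      ℓ i x = ℓ i y) :
    (⨅ i, LinearMap.ker (ℓ i)) ≤ W N := by
  suffices h : ∀ i ≤ N, (⨅ i, LinearMap.ker (ℓ i)) ≤ W i from h N le_rfl
  intro i
  induction i with
  | zero => intro _; rw [hW0]; exact le_top
  | succ i ih =>
    intro hi v hv
    by_contra hv'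
    have hH := ih (by omega)
    obtain ⟨hrank, ferr, -, herr, hu3⟩ := hB
    set f := chainFunction N ξ
    set h := f - B.project f - ferr with hh
    set φ := truncatedPhase (ξ i) v
    have hp : (1 : ℝ) ≤ p := by exact_mod_cast (Fact.out : p.Prime).one_le
    have hmem : ∀ {x y}, (∀ j, ℓ j y = ℓ j x) → y - x ∈ W i := by
      intro x y hxy
      refine hH ?_
      simp only [Submodule.mem_iInf, LinearMap.mem_ker, map_sub, sub_eq_zero]
      exact hxy
    -- By the induction hypothesis a coset of the common kernel lies in one coset of `W i`, on which
    -- `ξ i` is a single functional.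
    have hφ : ∀ x, ∃ (c : ℂ) (ψ : AddChar (Fin n → ZMod p) ℂ), ‖c‖ ≤ 1 ∧
        ∀ y, (∀ j, ℓ j y = ℓ j x) → φ y = c * ψ y := by
      intro x
      refine ⟨if ξ i x v ≠ 0 then 1 else 0, linChar (ξ i x), by split_ifs <;> simp, ?_⟩
      intro y hy
      have h1 : ξ i y = ξ i x := by
        rw [← (hW i (by omega)).apply_add x _ (hmem hy), add_sub_cancel]
      simp only [φ, truncatedPhase, h1, linChar_apply, ite_mul, one_mul, zero_mul]
    have hproj : ‖𝔼 x, (B.project f x : ℂ) * φ x‖ ≤ (p : ℝ) ^ D * √(((p : ℝ) ^ R D)⁻¹) := by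
      refine B.norm_expect_mul_le hrank ℓ hℓ _ _ (fun x => ?_) (fun x y hxy => ?_) hφ
        fun F hF => ?_
      · rw [Complex.norm_real]
        exact B.abs_project_le_one f (chainFunction_mem_Icc N ξ) x
      · rw [B.project_eq_of_atoms_r f hxy]
      · refine (hW i (by omega)).expect_mul_truncatedPhase_eq_zero (hH hv) F fun x t => ?_
        refine hF _ _ fun j => ?_
        have hvj : ℓ j v = 0 := LinearMap.mem_ker.1 ((Submodule.mem_iInf _).1 hv j)
        rw [map_add, map_smul, hvj, smul_zero, add_zero]
    have hferr : ‖𝔼 x, (ferr x : ℂ) * φ x‖ ≤ l2Norm ferr :=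
      norm_expect_mul_le_l2Norm _ _ (norm_truncatedPhase_le _ _)
    have hu : ‖𝔼 x, (h x : ℂ) * φ x‖ ≤ (p : ℝ) ^ D * u3Norm h := by
      refine (norm_expect_mul_le_of_piecewise ℓ _ _ _
        (norm_expect_mul_addChar_le_u3Norm h) hφ).trans ?_
      have h0 : 0 ≤ u3Norm h := (norm_nonneg _).trans (norm_expect_mul_addChar_le_u3Norm h 0)
      gcongr
      exact (Nat.le_add_right _ _).trans B.card_linear_add_card_quadratic_le
    have hsum : 𝔼 x, (f x : ℂ) * φ x = (𝔼 x, (B.project f x : ℂ) * φ x) +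
        (𝔼 x, (ferr x : ℂ) * φ x) + 𝔼 x, (h x : ℂ) * φ x := by
      rw [← Finset.expect_add_distrib, ← Finset.expect_add_distrib]
      refine Finset.expect_congr rfl fun x _ => ?_
      simp only [hh, Pi.sub_apply]
      push_cast
      ring
    have hlow := le_norm_expect_chainFunction_mul hW (by omega : i < N) (hH hv) hv'
    rw [hsum] at hlow
    have htri := norm_add₃_le (a := 𝔼 x, (B.project f x : ℂ) * φ x)
      (b := 𝔼 x, (ferr x : ℂ) * φ x) (c := 𝔼 x, (h x : ℂ) * φ x)
    have hu' : (p : ℝ) ^ D * u3Norm h < (p : ℝ) ^ D * (1 / (ω D : ℝ)) := by gcongr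
    linarith

theorem error_sum_le {p s D w r : ℕ} (hp : 2 ≤ p) {δ : ℝ} (hδ : 0 < δ) (hs : 1 ≤ s)
    (hsδ : (s : ℝ) ≤ δ ^ (-(1 / 3) : ℝ) / (60 * p))
    (hω : δ ^ (-(2 / 3) : ℝ) * (p : ℝ) ^ D ≤ (w : ℝ))
    (hR : 2 * ((D : ℝ) + 1 + Real.logb p (δ ^ (-(1 / 3) : ℝ))) ≤ (r : ℝ)) :
    (p : ℝ) ^ D * √(((p : ℝ) ^ r)⁻¹) + δ + (p : ℝ) ^ D * (1 / (w : ℝ)) ≤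
      (4 * p * ((4 + (s - 1) : ℕ) : ℝ))⁻¹ := by
  -- With `δ = t ^ 3` the three errors are at most `t`, `t ^ 3` and `t ^ 2`.
  obtain ⟨t, ht0, rfl⟩ : ∃ t : ℝ, 0 < t ∧ t ^ 3 = δ :=
    ⟨δ ^ (1 / 3 : ℝ), by positivity, by
      rw [← Real.rpow_natCast, ← Real.rpow_mul hδ.le]; norm_num⟩
  have e1 : (t ^ 3) ^ (-(1 / 3) : ℝ) = t⁻¹ := by
    rw [← Real.rpow_natCast, ← Real.rpow_mul ht0.le, ← Real.rpow_neg_one]; norm_num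
  have e2 : (t ^ 3) ^ (-(2 / 3) : ℝ) = (t ^ 2)⁻¹ := by
    rw [← Real.rpow_natCast, ← Real.rpow_mul ht0.le, ← Real.rpow_natCast, ← Real.rpow_neg ht0.le]
    norm_num
  rw [e1] at hsδ hR
  rw [e2] at hω
  have hp' : (2 : ℝ) ≤ p := by exact_mod_cast hp
  have hp0 : (0 : ℝ) < p := by linarith
  have hs' : (1 : ℝ) ≤ s := by exact_mod_cast hs
  have hst : 60 * p * s * t ≤ 1 := by
    rw [le_div_iff₀ (by positivity)] at hsδ
    calc 60 * p * s * t = s * (60 * p) * t := by ring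
      _ ≤ t⁻¹ * t := by gcongr
      _ = 1 := inv_mul_cancel₀ ht0.ne'
  have ht1 : t ≤ 1 / 60 := by nlinarith [mul_le_mul hp' hs' zero_le_one hp0.le]
  have b1 : (p : ℝ) ^ D * √(((p : ℝ) ^ r)⁻¹) ≤ t := by
    have h1 : ((p : ℝ) ^ D * t⁻¹) ^ 2 ≤ (p : ℝ) ^ r := by
      -- The `+ 1` in the rank condition yields a spare factor `p`, which is dropped.
      have h2 : ((p : ℝ) ^ (D + 1) * t⁻¹) ^ 2 ≤ (p : ℝ) ^ r := by
        have h3 := Real.rpow_le_rpow_of_exponent_le (by linarith : (1 : ℝ) ≤ p) hR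
        rw [mul_comm (2 : ℝ), Real.rpow_mul hp0.le, Real.rpow_add hp0,
          Real.rpow_logb hp0 (by linarith) (by positivity), Real.rpow_natCast] at h3
        exact_mod_cast h3
      refine le_trans ?_ h2
      gcongr
      · linarith
      · omega
    have h2 : √(((p : ℝ) ^ r)⁻¹) ≤ ((p : ℝ) ^ D * t⁻¹)⁻¹ := by
      refine Real.sqrt_le_iff.2 ⟨by positivity, ?_⟩
      rw [inv_pow]
      gcongr
    calc (p : ℝ) ^ D * √(((p : ℝ) ^ r)⁻¹) ≤ (p : ℝ) ^ D * ((p : ℝ) ^ D * t⁻¹)⁻¹ := by gcongr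
      _ = t := by field_simp
  have b2 : (p : ℝ) ^ D * (1 / (w : ℝ)) ≤ t ^ 2 := by
    have hpD : (0 : ℝ) < (p : ℝ) ^ D := by positivity
    have hw : (0 : ℝ) < w := lt_of_lt_of_le (by positivity) hω
    rw [mul_one_div, div_le_iff₀ hw]
    calc (p : ℝ) ^ D = t ^ 2 * ((t ^ 2)⁻¹ * (p : ℝ) ^ D) := by field_simp
      _ ≤ t ^ 2 * w := by gcongr
  -- The chain length `s + 3` is at most `4 * s`, and `60 * p * s * t ≤ 1`, so the right side is at
  -- least `1 / (16 p s) ≥ 60 t / 16`.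
  have b3 : 15 / 4 * t ≤ (4 * p * ((4 + (s - 1) : ℕ) : ℝ))⁻¹ := by
    have hN : ((4 + (s - 1) : ℕ) : ℝ) ≤ 4 * s := by
      have : 4 + (s - 1) ≤ 4 * s := by omega
      exact_mod_cast this
    calc 15 / 4 * t ≤ (4 * (p : ℝ) * (4 * s))⁻¹ := by
          rw [le_inv_comm₀ (by positivity) (by positivity), inv_eq_one_div,
            le_div_iff₀ (by positivity)]
          linarith
      _ ≤ _ := by gcongr
  nlinarith [mul_pos ht0 ht0, mul_le_mul_of_nonneg_left ht1 ht0.le,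
    mul_le_mul_of_nonneg_left ht1 (mul_pos ht0 ht0).le]

end Regularity

end QuadReg

theorem theoremB (p : ℕ) [Fact p.Prime] (δ : ℝ) (hδ : 0 < δ)
    (hδp : 1 ≤ ⌊δ ^ (-(1 / 3) : ℝ) / (60 * p)⌋₊) :
    ∃ n₀ : ℕ, ∀ n : ℕ, n₀ ≤ n →
      ∀ ω R : ℕ → ℕ, Monotone ω → Monotone R →
        (∀ d : ℕ, δ ^ (-(2 / 3) : ℝ) * (p : ℝ) ^ d ≤ (ω d : ℝ)) →
        (∀ d : ℕ, 2 * ((d : ℝ) + 1 + Real.logb p (δ ^ (-(1 / 3) : ℝ))) ≤ (R d : ℝ)) →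
        ∃ f : (Fin n → ZMod p) → ℝ, (∀ x, f x ∈ Set.Icc (0 : ℝ) 1) ∧
          ∀ (D : ℕ) (B : QuadReg.QuadraticFactor p n D),
            QuadReg.IsQuadraticRegularityPartition δ ω R f B →
              ∃ H : Submodule (ZMod p) (Fin n → ZMod p),
                B.linearLayer = H.quotientRel ∧
                twr (⌊δ ^ (-(1 / 3) : ℝ) / (60 * p)⌋₊ - 1) ≤
                  Module.finrank (ZMod p) ((Fin n → ZMod p) ⧸ H) := by
  set s := ⌊δ ^ (-(1 / 3) : ℝ) / (60 * p)⌋₊ with hs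
  have hsδ : (s : ℝ) ≤ δ ^ (-(1 / 3) : ℝ) / (60 * p) := Nat.floor_le (by positivity)
  -- The only demand on `n` is room for the whole chain: the four preliminary steps and one for each
  -- level of the tower.
  refine ⟨QuadReg.chainCodim (4 + (s - 1)), fun n hn ω R _ _ hω hR => ?_⟩
  obtain ⟨W, ξ, hW0, hW, hcodim⟩ := QuadReg.exists_refinement_chain (p := p)
    (V := Fin n → ZMod p) (4 + (s - 1)) (by simpa using hn)
  refine ⟨QuadReg.chainFunction (4 + (s - 1)) ξ, QuadReg.chainFunction_mem_Icc _ ξ,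
    fun D B hB => ?_⟩
  obtain ⟨ℓ, hℓ, hlayer⟩ := B.exists_linearLayer_eq
  refine ⟨_, hlayer, ?_⟩
  have hle := QuadReg.iInf_ker_le_of_isQuadraticRegularityPartition hW0 hW B hB
    (QuadReg.error_sum_le (Fact.out : p.Prime).two_le hδ hδp hsδ (hω D) (hR D)) ℓ hℓ
  have h1 := Submodule.finrank_mono hle
  have h2 := (⨅ i, LinearMap.ker (ℓ i)).finrank_quotient_add_finrank
  have h3 := (W (4 + (s - 1))).finrank_quotient_add_finrank
  have h4 := QuadReg.two_mul_twr_le_chainCodim (s - 1)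
  omega
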